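/- Let $1\le k\le n$ be integers, let $\varepsilon,\delta\in(0,1)$, and let $C\ge 100$ be a fixed constant. A stream of $n$ arms $\mathrm{arm}_1,\dots,\mathrm{arm}_n$ is given; pulling $\mathrm{arm}_i$ yields a fresh independent reward from an unknown distribution on $[0,1]$ with mean $\mu_i$. Let $\mu_{(k)}$ be the $k$-th largest of $\mu_1,\dots,\mu_n$, counted with multiplicity. Put $s_0=0$, $$s_\ell=\Big\lceil \frac{16}{\varepsilon^2}\log\Big(\frac{Ck}{\delta}\Big)2^\ell\Big\rceil\ (\ell\ge1),\qquad \tau_j=\frac{32}{\varepsilon^2}\log\Big(\frac{Ckj^2}{\delta}\Big)\ (j\ge 1),$$ with natural logarithms. Consider the following algorithm. Pull each of the first $k$ arms $s_1$ times when it arrives, record its estimated mean (the average of the observed rewards), and let $\mathcal A$ be the set of these arms; set $j\leftarrow 1$. For each arriving $\mathrm{arm}_i$ with $i>k$, in order: let $\mathrm{top}^o$ be an arm of $\mathcal A$ with minimum recorded estimated mean $\widehat\mu_{\mathrm{top}^o}$ (ties broken arbitrarily), and independently of everything else set $\alpha=\varepsilon/4$ with probability $\frac1{\log j+1}$ and $\alpha=\varepsilon/2$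 otherwise. In rounds $\ell=1,2,\dots$ pull $\mathrm{arm}_i$ another $s_\ell-s_{\ell-1}$ times, and let $\widehat\mu$ be the average of all $s_\ell$ rewards of $\mathrm{arm}_i$ observed so far. If $\widehat\mu\ge\widehat\mu_{\mathrm{top}^o}+\alpha$ and $s_\ell>\tau_j$, replace $\mathrm{top}^o$ in $\mathcal A$ by $\mathrm{arm}_i$ with recorded estimated mean $\widehat\mu$, set $j\leftarrow1$, and go to the next arm; if $\widehat\mu<\widehat\mu_{\mathrm{top}^o}+\alpha$, set $j\leftarrow j+1$ and go to the next arm; otherwise go to round $\ell+1$. After the last arm return (the indices of the arms in) $\mathcal A$. Then: 1. The algorithm makes a single pass over the stream and uses a single-arm memory: an arm is pulled only when it is the one stored arm, arms enter the memory only on arrival, and an arm is never revisited after a later arm has been pulled. (The memory for indices and recorded estimates is not counted.) 2. With probability at least $1-\delta$ the returned set consists of $k$ arms, each of mean at least $\mu_{(k)}-\varepsilon$. 3. There is a constant $K>0$ depending only on $C$ such that the expected total number of pulls is at most $K\,\frac{n}{\varepsilon^2}\big(1+\log\frac k\delta\big)$, and at most $K\,\frac{n}{\varepsilon^2}\log\frac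 k\delta$ whenever $k/\delta\ge 2$ (that is, whenever $k\ge2$ or $\delta\le\frac12$); so it is $O\big(\frac n{\varepsilon^2}\log\frac k\delta\big)$. -/

import Mathlib

namespace StreamingBandit

/-! ### Interactive bandit algorithms -/

/-- An interactive randomized algorithm on `n` arms with output in `β`: it stops with an output,
pulls an arm of its choice and continues depending on the observed reward, or flips a coin that
shows `true` with probability `q` and continues depending on the result. Rewards are accessible
through pulls only. -/
inductive Prog (n : ℕ) (β : Type) : Type
  | ret (b : β) : Prog n β
  | pull (i : Fin n) (next : ℝ → Prog n β) : Prog n β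
  | coin (q : ℝ) (next : Bool → Prog n β) : Prog n β

namespace Prog

variable {n : ℕ} {β γ : Type}

/-- Sequential composition. -/
def bind : Prog n β → (β → Prog n γ) → Prog n γ
  | ret b, f => f b
  | pull i next, f => pull i (fun x => bind (next x) f)
  | coin q next, f => coin q (fun c => bind (next c) f)

/-- `for a in l do ...`, with a state `b` that is passed from one iteration to the next. -/
def forEach {α : Type} (body : α → β → Prog n β) : List α → β → Prog n β
  | [], b => ret b
  | a :: l, b => bind (body a b) (forEach body l)

/-- Pull arm `i` exactly `m` times and return the sum of the `m` observed rewards. -/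
noncomputable def pullSum (i : Fin n) : ℕ → Prog n ℝ
  | 0 => ret 0
  | m + 1 => pull i (fun x => bind (pullSum i m) (fun y => ret (x + y)))

/-- Execution when the `m`-th pull of arm `i` yields `X i m` and the `m`-th coin with parameter `q`
shows `true` iff `U m < q`. Here `c i` is the number of earlier pulls of arm `i`, and `m` is the
number of earlier coin flips. The result is the output together with the list of the pulled arms,
in the order of the pulls. -/
noncomputable def exec (X : Fin n → ℕ → ℝ) (U : ℕ → ℝ) :
    Prog n β → (Fin n → ℕ) → ℕ → β × List (Fin n)
  | ret b, _, _ => (b, [])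
  | pull i next, c, m =>
      let r := exec X U (next (X i (c i))) (Function.update c i (c i + 1)) m
      (r.1, i :: r.2)
  | coin q next, c, m => exec X U (next (decide (U m < q))) c (m + 1)

/-- The output of an execution from the start. -/
noncomputable def output (P : Prog n β) (X : Fin n → ℕ → ℝ) (U : ℕ → ℝ) : β :=
  (P.exec X U (fun _ => 0) 0).1

/-- The sequence of the arms pulled by an execution from the start. -/
noncomputable def trace (P : Prog n β) (X : Fin n → ℕ → ℝ) (U : ℕ → ℝ) : List (Fin n) :=
  (P.exec X U (fun _ => 0) 0).2

/-- The total number of pulls. -/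
noncomputable def numPulls (P : Prog n β) (X : Fin n → ℕ → ℝ) (U : ℕ → ℝ) : ℕ :=
  (P.trace X U).length

end Prog

/-- The sequence `tr` of pulls can be carried out in a single pass over the stream
`arm 0, arm 1, …, arm (n - 1)` with a memory for `m` arms. Here `pos t` is the number of arms that
have arrived when the `t`-th pull is made, and `mem t` is the set of the arms stored at that moment.
Only stored arms can be pulled, and an arm can enter the memory only when it arrives, so that
an arm that has been discarded or passed over never comes back. -/
def SinglePassWithMemory {n : ℕ} (m : ℕ) (tr : List (Fin n)) : Prop :=
  ∃ (pos : ℕ → ℕ) (mem : ℕ → Finset (Fin n)),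
    Monotone pos ∧
    (∀ i ∈ mem 0, i.val < pos 0) ∧
    (∀ t, ∀ i ∈ mem (t + 1), i ∈ mem t ∨ (pos t ≤ i.val ∧ i.val < pos (t + 1))) ∧
    (∀ t, (mem t).card ≤ m) ∧
    (∀ (t : ℕ) (ht : t < tr.length), tr[t] ∈ mem t)

/-! ### The problem -/

/-- The `k`-th largest value, counted with multiplicity, among `f 0, …, f (n - 1)`:
the entry number `n - k` (counted from `0`) of the values sorted in nondecreasing order. -/
noncomputable def kthLargest {n : ℕ} (f : Fin n → ℝ) (k : ℕ) (hk : 1 ≤ k) (hkn : k ≤ n) : ℝ :=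
  f (Tuple.sort f ⟨n - k, by omega⟩)

/-- `A` consists of `k` arms whose means are at least the `k`-th largest mean minus `ε`. -/
def IsEpsTopK {n : ℕ} (f : Fin n → ℝ) (k : ℕ) (hk : 1 ≤ k) (hkn : k ≤ n) (ε : ℝ)
    (A : Finset (Fin n)) : Prop :=
  A.card = k ∧ ∀ a ∈ A, kthLargest f k hk hkn - ε ≤ f a

/-! ### The algorithm -/

/-- The parameters of the algorithm, with their ranges. -/
structure Params where
  k : ℕ
  ε : ℝ
  δ : ℝ
  C : ℝ
  one_le_k : 1 ≤ k
  ε_pos : 0 < ε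
  ε_lt_one : ε < 1
  δ_pos : 0 < δ
  δ_lt_one : δ < 1
  hundred_le_C : 100 ≤ C

namespace Params

/-- `s_ℓ = (16 / ε²) log (C k / δ) 2 ^ ℓ`, rounded up to an integer, and `s_0 = 0`: the number of
pulls of an arm up to round `ℓ`. -/
noncomputable def s (p : Params) (l : ℕ) : ℕ :=
  if l = 0 then 0 else ⌈16 / p.ε ^ 2 * Real.log (p.C * p.k / p.δ) * 2 ^ l⌉₊

/-- `τ_j = (32 / ε²) log (C k j² / δ)`. -/
noncomputable def tau (p : Params) (j : ℕ) : ℝ :=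
  32 / p.ε ^ 2 * Real.log (p.C * p.k * (j : ℝ) ^ 2 / p.δ)

lemma one_le_base (p : Params) : 1 ≤ 16 / p.ε ^ 2 * Real.log (p.C * p.k / p.δ) := by
  have hk : (1 : ℝ) ≤ p.k := by exact_mod_cast p.one_le_k
  have hC := p.hundred_le_C
  have h1 : (100 : ℝ) ≤ p.C * p.k / p.δ := by
    rw [le_div_iff₀ p.δ_pos]
    nlinarith [p.δ_lt_one, p.δ_pos]
  have h2 : (1 : ℝ) ≤ Real.log (p.C * p.k / p.δ) := by
    rw [Real.le_log_iff_exp_le (by linarith)]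
    linarith [Real.exp_one_lt_d9]
  have h3 : (1 : ℝ) ≤ 16 / p.ε ^ 2 := by
    rw [le_div_iff₀ (pow_pos p.ε_pos 2)]
    nlinarith [p.ε_lt_one, p.ε_pos]
  nlinarith

lemma s_lt_s_succ (p : Params) (l : ℕ) : p.s l < p.s (l + 1) := by
  have hb := p.one_le_base
  have hp : (1 : ℝ) ≤ 2 ^ l := one_le_pow₀ (by norm_num)
  unfold s
  rw [if_neg (Nat.succ_ne_zero l)]
  split_ifs with h
  · exact Nat.ceil_pos.mpr (by positivity)
  · rw [Nat.lt_ceil]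
    refine (Nat.ceil_lt_add_one (by positivity)).trans_le ?_
    rw [pow_succ (2 : ℝ) l]
    nlinarith [mul_le_mul hb hp (by norm_num) (by linarith)]

end Params

variable {n : ℕ}

/-- The state kept between two arriving arms: the set `𝒜` of the selected arms (their indices), the
recorded estimated means, and the counter `j`. -/
structure State (n : ℕ) where
  A : Finset (Fin n)
  est : Fin n → ℝ
  j : ℕ

/-- The arms of `𝒜` of minimum estimated mean. -/
noncomputable def State.argmin (st : State n) : Finset (Fin n) :=
  st.A.filter (fun a => ∀ b ∈ st.A, st.est a ≤ st.est b)

/-- The `while true` loop for arm `i` against the threshold `θ = μ̂(topᵒ) + α`, entered in round `l`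
after pulls with sum of rewards `S`. It returns whether the arm is accepted, and its estimated mean,
the average of all rewards obtained from it. -/
noncomputable def loop (p : Params) (i : Fin n) (θ : ℝ) (j : ℕ) (l : ℕ) (S : ℝ) :
    Prog n (Bool × ℝ) :=
  Prog.bind (Prog.pullSum i (p.s l - p.s (l - 1))) fun x =>
    if _h1 : (S + x) / p.s l ≥ θ ∧ (p.s l : ℝ) > p.tau j then
      Prog.ret (true, (S + x) / p.s l)
    else if _h2 : (S + x) / p.s l < θ then
      Prog.ret (false, (S + x) / p.s l)
    else
      loop p i θ j (l + 1) (S + x)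
termination_by ⌊p.tau j⌋₊ + 1 - p.s l
decreasing_by
  have h3 : (p.s l : ℝ) ≤ p.tau j := by
    by_contra h
    exact _h1 ⟨not_lt.mp _h2, not_le.mp h⟩
  have h4 : p.s l ≤ ⌊p.tau j⌋₊ := Nat.le_floor h3
  have h5 := p.s_lt_s_succ l
  omega

/-- The first `k` arms: pull arm `i` exactly `s_1` times and insert it into `𝒜`. -/
noncomputable def initStep (p : Params) (i : Fin n) (st : State n) : Prog n (State n) :=
  Prog.bind (Prog.pullSum i (p.s 1)) fun x =>
    Prog.ret { A := insert i st.A, est := Function.update st.est i (x / p.s 1), j := st.j }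

/-- The later arms: draw `α`, compare arm `i` with `topᵒ`, the arm of minimum estimated mean in `𝒜`
(`tie` selects among several minimizers), and let it take the place of `topᵒ` if accepted. -/
noncomputable def mainStep (p : Params) (tie : Finset (Fin n) → Fin n) (i : Fin n)
    (st : State n) : Prog n (State n) :=
  Prog.coin (1 / (Real.log st.j + 1)) fun c =>
    let α : ℝ := if c then p.ε / 4 else p.ε / 2
    let top : Fin n := tie st.argmin
    Prog.bind (loop p i (st.est top + α) st.j 1 0) fun r =>
      if r.1 then
        Prog.ret { A := insert i (st.A.erase top), est := Function.update st.est i r.2, j := 1 }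
      else
        Prog.ret { A := st.A, est := st.est, j := st.j + 1 }

/-- The streaming algorithm for the selection of `k` arms out of `n`. -/
noncomputable def topKAlgorithm (p : Params) (n : ℕ) (tie : Finset (Fin n) → Fin n) :
    Prog n (Finset (Fin n)) :=
  Prog.bind
    (Prog.forEach (initStep p) ((List.finRange n).take p.k) { A := ∅, est := fun _ => 0, j := 1 })
    fun st₀ =>
      Prog.bind (Prog.forEach (mainStep p tie) ((List.finRange n).drop p.k) st₀) fun st =>
        Prog.ret st.A

end StreamingBandit

open MeasureTheory ProbabilityTheory StreamingBandit

/-! In every execution the algorithm is a fold over the arriving arms (`exec_topKAlgorithm`): an arm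
is accepted exactly when its averages pass the threshold in all rounds up to the first one with `s_ℓ
> τ_j`. Arms are pulled in increasing order, which gives the single pass. Each arm meets a state
that depends on earlier arms and coins only, so a total cost is controlled by a potential whose
expected decrease pays for each step (`lintegral_runCost_le`).

Correctness. Let κ be the k-th largest mean, T a set of k arms of mean at least κ, and h = κ - 5ε/8.
Suppose that no arm of T is underestimated by more than ε/8 and no arm of mean below κ - ε is
recorded with an estimate at least h. While the smallest recorded estimate is below h, every
arriving arm of T is accepted and no arm with estimate at least h is evicted; once the minimum
reaches h, it stays there. In both cases all final estimates are at least h, hence all final means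
at least κ - ε (`Invariant.step`, `Invariant.final`).

The confidence levels involve k and j but not n, and j is reset, so a union bound over all arms
fails. Instead the expected number of overestimated later arms is at most δ/(Ck) times an initial
potential of at most 38k (`lintegral_overCost_step_le`). The potential is the sum of a decreasing
logistic function of the recorded estimates, plus 2/j times a weight proportional to the slope of
that function at the smallest estimate. A rejection lowers 2/j by at least 1/j², matching the
failure probability; an acceptance lifts an estimate by at least ε/4, and the logistic drop pays for
resetting j. If the smallest estimate is too low for its weight to pay, the arriving arm is accepted
with probability at least 1/2, and the logistic drop pays.

Pulls. A credit of order `base` · (1 + log j)² pays for long comparisons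
(`lintegral_pullCost_step_le`): they are either rare, because they need the coin that selects ε/4,
or likely to end in an acceptance that resets j and releases credit. -/

namespace StreamingBandit

universe u

/-! ### Compositional semantics of executions -/

namespace Prog

variable {n : ℕ} {β γ κ : Type}

lemma bind_assoc (P : Prog n β) (f : β → Prog n γ) (g : γ → Prog n κ) :
    bind (bind P f) g = bind P (fun b => bind (f b) g) := by
  induction P with
  | ret b => rfl
  | pull i next ih => simp [bind, ih]
  | coin q next ih => simp [bind, ih]

lemma bind_ret (P : Prog n β) : bind P ret = P := by
  induction P with
  | ret b => rfl
  | pull i next ih => simp [bind, ih]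
  | coin q next ih => simp [bind, ih]

/-- Started with the counters `c` and `m`, the program `P` outputs `b` after the pulls `tr` and
leaves the counters `c'` and `m'`. -/
def Steps (X : Fin n → ℕ → ℝ) (U : ℕ → ℝ) (P : Prog n β) (c : Fin n → ℕ) (m : ℕ)
    (b : β) (tr : List (Fin n)) (c' : Fin n → ℕ) (m' : ℕ) : Prop :=
  ∀ (γ : Type) (f : β → Prog n γ),
    exec X U (bind P f) c m = ((exec X U (f b) c' m').1, tr ++ (exec X U (f b) c' m').2)

variable {X : Fin n → ℕ → ℝ} {U : ℕ → ℝ}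

lemma Steps.exec_eq {P : Prog n β} {c c' : Fin n → ℕ} {m m' : ℕ} {b : β} {tr : List (Fin n)}
    (h : Steps X U P c m b tr c' m') : exec X U P c m = (b, tr) := by
  have := h β ret
  rw [bind_ret] at this
  simpa [exec] using this

lemma steps_ret (b : β) (c : Fin n → ℕ) (m : ℕ) : Steps X U (ret b) c m b [] c m := by
  intro γ f
  simp [bind]

/-- Because `Steps` quantifies over all continuations, composition reduces to `bind_assoc`. The
final counters are not part of the value of `exec`; only a continuation makes them visible. -/
lemma Steps.bind {P : Prog n β} {f : β → Prog n γ} {c c' c'' : Fin n → ℕ} {m m' m'' : ℕ}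
    {b : β} {b' : γ} {tr tr' : List (Fin n)} (h : Steps X U P c m b tr c' m')
    (h' : Steps X U (f b) c' m' b' tr' c'' m'') :
    Steps X U (P.bind f) c m b' (tr ++ tr') c'' m'' := by
  intro κ g
  rw [bind_assoc, h, h']
  simp

lemma Steps.coin {q : ℝ} {next : Bool → Prog n β} {c c' : Fin n → ℕ} {m m' : ℕ}
    {b : β} {tr : List (Fin n)} (h : Steps X U (next (decide (U m < q))) c (m + 1) b tr c' m') :
    Steps X U (coin q next) c m b tr c' m' := by
  intro κ g
  simp only [Prog.bind, exec]
  exact h κ g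

lemma steps_pullSum (i : Fin n) (N : ℕ) (c : Fin n → ℕ) (m : ℕ) :
    Steps X U (pullSum i N) c m (∑ r ∈ Finset.range N, X i (c i + r)) (List.replicate N i)
      (Function.update c i (c i + N)) m := by
  induction N generalizing c with
  | zero =>
    simp only [Finset.range_zero, Finset.sum_empty, List.replicate_zero, Nat.add_zero,
      Function.update_eq_self]
    exact steps_ret 0 c m
  | succ N ih =>
    intro κ g
    simp only [pullSum, Prog.bind, exec, bind_assoc]
    rw [ih]
    have h1 : X i (c i) + ∑ r ∈ Finset.range N, X i (Function.update c i (c i + 1) i + r)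
        = ∑ r ∈ Finset.range (N + 1), X i (c i + r) := by
      rw [Finset.sum_range_succ', add_comm]
      simp [add_assoc, add_comm 1]
    have h2 : Function.update (Function.update c i (c i + 1)) i
        (Function.update c i (c i + 1) i + N) = Function.update c i (c i + (N + 1)) := by
      simp [add_assoc, add_comm 1]
    rw [h1, h2]
    simp [List.replicate_succ]

end Prog

variable {n : ℕ}

/-! ### The number of rounds -/

namespace Params

variable (p : Params)

lemma s_strictMono : StrictMono p.s := strictMono_nat_of_lt_succ p.s_lt_s_succ

lemma exists_tau_lt_s (j : ℕ) : ∃ l, 1 ≤ l ∧ p.tau j < p.s l := by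
  refine ⟨⌊p.tau j⌋₊ + 1, by omega, ?_⟩
  calc p.tau j < (⌊p.tau j⌋₊ + 1 : ℕ) := by exact_mod_cast Nat.lt_floor_add_one _
    _ ≤ p.s (⌊p.tau j⌋₊ + 1) := by exact_mod_cast p.s_strictMono.le_apply

open Classical in
/-- The first round in which an arm can be accepted. -/
noncomputable def lastRound (j : ℕ) : ℕ := Nat.find (p.exists_tau_lt_s j)

lemma one_le_lastRound (j : ℕ) : 1 ≤ p.lastRound j := (Nat.find_spec (p.exists_tau_lt_s j)).1

lemma tau_lt_s_lastRound (j : ℕ) : p.tau j < p.s (p.lastRound j) :=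
  (Nat.find_spec (p.exists_tau_lt_s j)).2

lemma s_le_tau {j l : ℕ} (h1 : 1 ≤ l) (h : l < p.lastRound j) : (p.s l : ℝ) ≤ p.tau j := by
  by_contra h2
  exact Nat.find_min (p.exists_tau_lt_s j) h ⟨h1, not_le.mp h2⟩

/-- The average of the first `s_l` rewards. -/
noncomputable def avg (x : ℕ → ℝ) (l : ℕ) : ℝ := (∑ r ∈ Finset.range (p.s l), x r) / p.s l

/-- An arm with rewards `x` is accepted against the threshold `θ` at counter `j`. -/
def Accepts (θ : ℝ) (j : ℕ) (x : ℕ → ℝ) : Prop :=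
  ∀ l ∈ Finset.Icc 1 (p.lastRound j), θ ≤ p.avg x l

/-- An upper bound for the number of pulls of an arm with rewards `x` against the threshold `θ` at
counter `j`. -/
noncomputable def pullBound (θ : ℝ) (j : ℕ) (x : ℕ → ℝ) : ℕ :=
  p.s 1 + ∑ l ∈ Finset.Ico 1 (p.lastRound j),
    if θ ≤ p.avg x l then p.s (l + 1) - p.s l else 0

lemma sum_range_s_add (x : ℕ → ℝ) (l : ℕ) :
    ∑ r ∈ Finset.range (p.s (l - 1)), x r
      + ∑ r ∈ Finset.range (p.s l - p.s (l - 1)), x (p.s (l - 1) + r)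
      = ∑ r ∈ Finset.range (p.s l), x r := by
  rw [← Finset.sum_range_add]
  congr 2
  have := p.s_strictMono.monotone (Nat.sub_le l 1)
  omega

end Params

open Prog Params

/-- Before `lastRound j` acceptance is impossible, since `s l ≤ tau j`, and in that round the loop
must stop; so acceptance means passing all remaining rounds. The bound on `N` charges an increment
after every passed round, even one following a failure, so that its expectation is a sum of
single-round probabilities. -/
lemma steps_loop (p : Params) (X : Fin n → ℕ → ℝ) (U : ℕ → ℝ) (i : Fin n) (θ : ℝ) (j : ℕ)
    (m : ℕ) (l : ℕ) (c : Fin n → ℕ) (hl : 1 ≤ l) (hlR : l ≤ p.lastRound j)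
    (hc : c i = p.s (l - 1)) :
    ∃ (b : Bool) (e : ℝ) (N : ℕ) (c' : Fin n → ℕ),
      Steps X U (loop p i θ j l (∑ r ∈ Finset.range (p.s (l - 1)), X i r)) c m (b, e)
        (List.replicate N i) c' m ∧
      (b = true ↔ ∀ r ∈ Finset.Icc l (p.lastRound j), θ ≤ p.avg (X i) r) ∧
      (b = true → e = p.avg (X i) (p.lastRound j)) ∧
      N ≤ (p.s l - p.s (l - 1)) + ∑ r ∈ Finset.Ico l (p.lastRound j),
        (if θ ≤ p.avg (X i) r then p.s (r + 1) - p.s r else 0) ∧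
      ∀ a ≠ i, c' a = c a := by
  obtain ⟨d, hd⟩ : ∃ d, p.lastRound j = l + d := ⟨p.lastRound j - l, by omega⟩
  induction d generalizing l c with
  | zero =>
    have hR : l = p.lastRound j := by omega
    have hτ : p.tau j < p.s l := hR ▸ p.tau_lt_s_lastRound j
    rw [loop]
    have hps := steps_pullSum (X := X) (U := U) i (p.s l - p.s (l - 1)) c m
    rw [hc] at hps
    by_cases h : θ ≤ p.avg (X i) l
    · refine ⟨true, p.avg (X i) l, p.s l - p.s (l - 1),
        Function.update c i (p.s (l - 1) + (p.s l - p.s (l - 1))), ?_, ?_, ?_, ?_, ?_⟩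
      rotate_left
      · simp [← hR, h]
      · simp [← hR]
      · simp
      rotate_left 1
      · rw [← List.append_nil (List.replicate _ _)]
        refine hps.bind ?_
        rw [sum_range_s_add, dif_pos ⟨h, hτ⟩]
        exact steps_ret _ _ _
      · intro a ha
        simp [ha]
    · refine ⟨false, p.avg (X i) l, p.s l - p.s (l - 1),
        Function.update c i (p.s (l - 1) + (p.s l - p.s (l - 1))), ?_, ?_, ?_, ?_, ?_⟩
      rotate_left
      · simp [← hR]; simpa using h
      · simp
      · simp
      rotate_left 1
      · rw [← List.append_nil (List.replicate _ _)]
        refine hps.bind ?_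
        rw [sum_range_s_add, dif_neg (fun h' => h h'.1),
          dif_pos (show (∑ r ∈ Finset.range (p.s l), X i r) / (p.s l : ℝ) < θ from not_le.mp h)]
        exact steps_ret _ _ _
      · intro a ha
        simp [ha]
  | succ d ih =>
    have hlt : l < p.lastRound j := by omega
    rw [loop]
    have hps := steps_pullSum (X := X) (U := U) i (p.s l - p.s (l - 1)) c m
    rw [hc] at hps
    have hs := p.s_strictMono.monotone (Nat.sub_le l 1)
    by_cases h : θ ≤ p.avg (X i) l
    · obtain ⟨b, e, N, c', h1, h2, h3, h4, h5⟩ :=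
        ih (l + 1) (Function.update c i (p.s (l - 1) + (p.s l - p.s (l - 1)))) (by omega)
          (by omega) (by simp; omega) (by omega)
      refine ⟨b, e, (p.s l - p.s (l - 1)) + N, c', ?_, ?_, h3, ?_, ?_⟩
      · rw [← List.replicate_append_replicate]
        refine hps.bind ?_
        rw [sum_range_s_add, dif_neg,
          dif_neg (show ¬ (∑ r ∈ Finset.range (p.s l), X i r) / (p.s l : ℝ) < θ from not_lt.mpr h)]
        · simpa using h1
        · rintro ⟨-, h'⟩
          exact absurd (p.s_le_tau hl hlt) (not_le.mpr h')
      · rw [h2, ← Finset.insert_Icc_succ_left_eq_Icc hlt.le]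
        simp [h]
      · rw [← Finset.add_sum_Ioo_eq_sum_Ico hlt, if_pos h]
        simp only [Nat.add_sub_cancel] at h4
        have : Finset.Ioo l (p.lastRound j) = Finset.Ico (l + 1) (p.lastRound j) := by
          ext; simp
        rw [this]
        omega
      · intro a ha
        rw [h5 a ha]
        simp [ha]
    · refine ⟨false, p.avg (X i) l, p.s l - p.s (l - 1),
        Function.update c i (p.s (l - 1) + (p.s l - p.s (l - 1))), ?_, ?_, ?_, ?_, ?_⟩
      rotate_left
      · simp only [Bool.false_eq_true, Finset.mem_Icc, false_iff, not_forall]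
        exact ⟨l, ⟨le_rfl, hlR⟩, h⟩
      · simp
      · simp
      rotate_left 1
      · rw [← List.append_nil (List.replicate _ _)]
        refine hps.bind ?_
        rw [sum_range_s_add, dif_neg (fun h' => h h'.1),
          dif_pos (show (∑ r ∈ Finset.range (p.s l), X i r) / (p.s l : ℝ) < θ from not_le.mp h)]
        exact steps_ret _ _ _
      · intro a ha
        simp [ha]

/-! ### The algorithm as a fold over the arriving arms -/

/-- The threshold that an arriving arm has to pass, when the seed of the coin is `u`. -/
noncomputable def threshold (p : Params) (tie : Finset (Fin n) → Fin n) (st : State n) (u : ℝ) :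
    ℝ :=
  st.est (tie st.argmin) + if u < 1 / (Real.log st.j + 1) then p.ε / 4 else p.ε / 2

open Classical in
/-- The state after an arm with rewards `x` has been compared, when the seed of the coin is `u`. -/
noncomputable def stepState (p : Params) (tie : Finset (Fin n) → Fin n) (i : Fin n)
    (st : State n) (x : ℕ → ℝ) (u : ℝ) : State n :=
  if p.Accepts (threshold p tie st u) st.j x then
    { A := insert i (st.A.erase (tie st.argmin)),
      est := Function.update st.est i (p.avg x (p.lastRound st.j)), j := 1 }
  else { A := st.A, est := st.est, j := st.j + 1 }

/-- The state after the arms of a list have been compared, when `m` coins were flipped before. -/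
noncomputable def runState (p : Params) (tie : Finset (Fin n) → Fin n) (X : Fin n → ℕ → ℝ)
    (U : ℕ → ℝ) : List (Fin n) → State n → ℕ → State n
  | [], st, _ => st
  | a :: l, st, m => runState p tie X U l (stepState p tie a st (X a) (U m)) (m + 1)

/-- The total cost of the comparisons with the arms of a list. -/
noncomputable def runCost (p : Params) (tie : Finset (Fin n) → Fin n)
    (cost : Fin n → State n → (ℕ → ℝ) → ℝ → ENNReal) (X : Fin n → ℕ → ℝ)
    (U : ℕ → ℝ) : List (Fin n) → State n → ℕ → ENNReal
  | [], _, _ => 0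
  | a :: l, st, m => cost a st (X a) (U m) +
      runCost p tie cost X U l (stepState p tie a st (X a) (U m)) (m + 1)

/-- The bound for the number of pulls in a comparison. -/
noncomputable def pullCost (p : Params) (tie : Finset (Fin n) → Fin n) (_i : Fin n)
    (st : State n) (x : ℕ → ℝ) (u : ℝ) : ENNReal :=
  p.pullBound (threshold p tie st u) st.j x

lemma steps_mainStep (p : Params) (tie : Finset (Fin n) → Fin n) (X : Fin n → ℕ → ℝ) (U : ℕ → ℝ)
    (i : Fin n) (st : State n) (c : Fin n → ℕ) (m : ℕ) (hc : c i = 0) :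
    ∃ (N : ℕ) (c' : Fin n → ℕ),
      Steps X U (mainStep p tie i st) c m (stepState p tie i st (X i) (U m))
        (List.replicate N i) c' (m + 1) ∧
      (N : ENNReal) ≤ pullCost p tie i st (X i) (U m) ∧ ∀ a ≠ i, c' a = c a := by
  obtain ⟨b, e, N, c', h1, h2, h3, h4, h5⟩ := steps_loop p X U i (threshold p tie st (U m)) st.j
    (m + 1) 1 c le_rfl (p.one_le_lastRound _) (by simp [hc, Params.s])
  refine ⟨N, c', ?_, ?_, h5⟩
  · refine Steps.coin ?_
    rw [← List.append_nil (List.replicate _ _)]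
    simp only [decide_eq_true_eq]
    have hs0 : p.s 0 = 0 := by simp [Params.s]
    simp only [Nat.sub_self, hs0, Finset.range_zero, Finset.sum_empty] at h1
    refine Steps.bind h1 ?_
    unfold stepState
    by_cases hb : b = true
    · rw [if_pos hb, if_pos (show p.Accepts _ _ _ from h2.mp hb), ← h3 hb]
      exact steps_ret _ _ _
    · rw [if_neg hb, if_neg (show ¬ p.Accepts _ _ _ from fun h => hb (h2.mpr h))]
      exact steps_ret _ _ _
  · unfold pullCost pullBound
    have hs0 : p.s 0 = 0 := by simp [Params.s]
    simp only [Nat.sub_self, hs0, Nat.sub_zero] at h4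
    exact_mod_cast h4

lemma pairwise_le_replicate_append {i : Fin n} {l tr : List (Fin n)} (N : ℕ)
    (hl : (i :: l).Pairwise (· < ·)) (htr : tr.Pairwise (· ≤ ·)) (hsub : ∀ a ∈ tr, a ∈ l) :
    (List.replicate N i ++ tr).Pairwise (· ≤ ·) := by
  rw [List.pairwise_append]
  refine ⟨List.pairwise_replicate.mpr (Or.inr le_rfl), htr, ?_⟩
  intro a ha b hb
  rw [List.eq_of_mem_replicate ha]
  exact (List.rel_of_pairwise_cons hl (hsub b hb)).le

/-- The list is strictly increasing, so an arm's counter is still 0 when its turn comes and its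
averages start at its first reward. -/
lemma steps_forEach_mainStep (p : Params) (tie : Finset (Fin n) → Fin n) (X : Fin n → ℕ → ℝ)
    (U : ℕ → ℝ) (l : List (Fin n)) (hl : l.Pairwise (· < ·)) (st : State n) (c : Fin n → ℕ)
    (m : ℕ) (hc : ∀ a ∈ l, c a = 0) :
    ∃ (tr : List (Fin n)) (c' : Fin n → ℕ) (m' : ℕ),
      Steps X U (forEach (mainStep p tie) l st) c m (runState p tie X U l st m) tr c' m' ∧
      tr.Pairwise (· ≤ ·) ∧ (∀ a ∈ tr, a ∈ l) ∧
      (tr.length : ENNReal) ≤ runCost p tie (pullCost p tie) X U l st m := by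
  induction l generalizing st c m with
  | nil => exact ⟨[], c, m, steps_ret _ _ _, by simp, by simp, by simp⟩
  | cons i l ih =>
    obtain ⟨N, c', h1, h2, h3⟩ := steps_mainStep p tie X U i st c m (hc i (by simp))
    obtain ⟨tr, c'', m'', h4, h5, h6, h7⟩ := ih hl.of_cons
      (stepState p tie i st (X i) (U m)) c' (m + 1) (fun a ha => by
        rw [h3 a (List.rel_of_pairwise_cons hl ha).ne', hc a (by simp [ha])])
    refine ⟨List.replicate N i ++ tr, c'', m'', h1.bind h4,
      pairwise_le_replicate_append N hl h5 h6, ?_, ?_⟩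
    · intro a ha
      rcases List.mem_append.mp ha with h | h
      · simp [List.eq_of_mem_replicate h]
      · simp [h6 a h]
    · simp only [List.length_append, List.length_replicate, Nat.cast_add, runCost]
      gcongr

/-- The state after the arms of a list have been inserted. -/
noncomputable def initState (p : Params) (X : Fin n → ℕ → ℝ) : List (Fin n) → State n → State n
  | [], st => st
  | a :: l, st => initState p X l
      { A := insert a st.A, est := Function.update st.est a (p.avg (X a) 1), j := st.j }

lemma steps_forEach_initStep (p : Params) (X : Fin n → ℕ → ℝ)
    (U : ℕ → ℝ) (l : List (Fin n)) (hl : l.Pairwise (· < ·)) (st : State n) (c : Fin n → ℕ)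
    (m : ℕ) (hc : ∀ a ∈ l, c a = 0) :
    ∃ (tr : List (Fin n)) (c' : Fin n → ℕ),
      Steps X U (forEach (initStep p) l st) c m (initState p X l st) tr c' m ∧
      tr.Pairwise (· ≤ ·) ∧ (∀ a ∈ tr, a ∈ l) ∧ tr.length = l.length * p.s 1 ∧
      ∀ a ∉ l, c' a = c a := by
  induction l generalizing st c with
  | nil => exact ⟨[], c, steps_ret _ _ _, by simp, by simp, by simp, by simp⟩
  | cons i l ih =>
    have h1 : Steps X U (initStep p i st) c m
        { A := insert i st.A, est := Function.update st.est i (p.avg (X i) 1), j := st.j }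
        (List.replicate (p.s 1) i) (Function.update c i (c i + p.s 1)) m := by
      rw [← List.append_nil (List.replicate _ _)]
      refine (steps_pullSum i (p.s 1) c m).bind ?_
      simp only [hc i (by simp), zero_add]
      exact steps_ret _ _ _
    obtain ⟨tr, c'', h4, h5, h6, h7, h8⟩ := ih hl.of_cons
      { A := insert i st.A, est := Function.update st.est i (p.avg (X i) 1), j := st.j }
      (Function.update c i (c i + p.s 1)) (fun a ha => by
        rw [Function.update_of_ne (List.rel_of_pairwise_cons hl ha).ne', hc a (by simp [ha])])
    refine ⟨_, c'', h1.bind h4, pairwise_le_replicate_append _ hl h5 h6, ?_, ?_, ?_⟩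
    · intro a ha
      rcases List.mem_append.mp ha with h | h
      · simp [List.eq_of_mem_replicate h]
      · simp [h6 a h]
    · simp [h7]; ring
    · intro a ha
      simp only [List.mem_cons, not_or] at ha
      rw [h8 a ha.2, Function.update_of_ne ha.1]

/-- The state after the first `k` arms. -/
noncomputable def startState (p : Params) (n : ℕ) (X : Fin n → ℕ → ℝ) : State n :=
  initState p X ((List.finRange n).take p.k) { A := ∅, est := fun _ => 0, j := 1 }

/-- The bridge from the program to the recursions `runState` and `runCost`; everything probabilistic
happens on the latter. -/
theorem exec_topKAlgorithm (p : Params) (n : ℕ) (tie : Finset (Fin n) → Fin n)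
    (X : Fin n → ℕ → ℝ) (U : ℕ → ℝ) :
    (topKAlgorithm p n tie).output X U
        = (runState p tie X U ((List.finRange n).drop p.k) (startState p n X) 0).A ∧
      ((topKAlgorithm p n tie).trace X U).Pairwise (· ≤ ·) ∧
      ((topKAlgorithm p n tie).numPulls X U : ENNReal) ≤ (n * p.s 1 : ℕ) +
        runCost p tie (pullCost p tie) X U ((List.finRange n).drop p.k) (startState p n X) 0 := by
  have hpw := List.pairwise_lt_finRange n
  rw [← List.take_append_drop p.k (List.finRange n), List.pairwise_append] at hpw
  obtain ⟨hp1, hp2, hp3⟩ := hpw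
  obtain ⟨tr, c, h1, h2, h3, h4, h5⟩ := steps_forEach_initStep p X U _ hp1
    { A := ∅, est := fun _ => 0, j := 1 } (fun _ => 0) 0 (by simp)
  obtain ⟨tr', c', m', g1, g2, g3, g4⟩ := steps_forEach_mainStep p tie X U _ hp2
    (startState p n X) c 0 (fun a ha => h5 a (fun ha' => lt_irrefl _ (hp3 a ha' a ha)))
  have key : Steps X U (topKAlgorithm p n tie) (fun _ => 0) 0 _ (tr ++ (tr' ++ [])) c' m' :=
    h1.bind (g1.bind (steps_ret _ _ _))
  have he := key.exec_eq
  rw [List.append_nil] at he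
  refine ⟨?_, ?_, ?_⟩
  · rw [Prog.output, he]
  · rw [Prog.trace, he, List.pairwise_append]
    exact ⟨h2, g2, fun a ha b hb => (hp3 a (h3 a ha) b (g3 b hb)).le⟩
  · rw [Prog.numPulls, Prog.trace, he]
    simp only [List.length_append, Nat.cast_add]
    refine add_le_add ?_ g4
    rw [h4]
    have : ((List.finRange n).take p.k).length ≤ n := by simp
    exact_mod_cast Nat.mul_le_mul_right _ this

/-- The memory holds just the arm being pulled, and the stream has advanced exactly to that arm; the
next pull concerns the same arm or one not yet arrived. After the last pull the memory is empty and
the position is `n`, which keeps it monotone. -/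
theorem singlePassWithMemory_one_of_pairwise {tr : List (Fin n)} (h : tr.Pairwise (· ≤ ·)) :
    SinglePassWithMemory 1 tr := by
  classical
  refine ⟨fun t => if ht : t < tr.length then (tr[t]).val + 1 else n,
    fun t => if ht : t < tr.length then {tr[t]} else ∅, ?_, ?_, ?_, ?_, ?_⟩
  · intro s t hst
    by_cases ht : t < tr.length
    · have hs : s < tr.length := lt_of_le_of_lt hst ht
      simp only [ht, hs, dif_pos]
      rcases hst.eq_or_lt with rfl | hlt
      · exact le_rfl
      · exact Nat.succ_le_succ (List.pairwise_iff_getElem.mp h s t hs ht hlt)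
    · simp only [ht, dif_neg, not_false_eq_true]
      split_ifs
      · exact (tr[s]).isLt
      · exact le_rfl
  · intro i hi
    by_cases h0 : 0 < tr.length
    · simp only [h0, dif_pos, Finset.mem_singleton] at hi ⊢
      subst hi
      exact Nat.lt_succ_self _
    · simp [h0] at hi
  · intro t i hi
    by_cases ht : t + 1 < tr.length
    · have ht' : t < tr.length := by omega
      simp only [ht, ht', dif_pos, Finset.mem_singleton] at hi ⊢
      subst hi
      have := List.pairwise_iff_getElem.mp h t (t + 1) ht' ht (by omega)
      rcases this.eq_or_lt with h1 | h1
      · exact Or.inl h1.symm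
      · exact Or.inr ⟨h1, Nat.lt_succ_self _⟩
    · simp [ht] at hi
  · intro t
    dsimp only
    split_ifs <;> simp
  · intro t ht
    simp [ht]

end StreamingBandit

/-! ### The probabilistic model and Hoeffding's inequality -/

namespace StreamingBandit

open Params
open scoped ENNReal

variable {n : ℕ} {Ω : Type u} [MeasurableSpace Ω]

/-- The rewards `X i m` have law `ν i` on `[0, 1]`, the seeds `U m` are uniform, and all of them are
independent. -/
structure IsModel (ν : Fin n → Measure ℝ) (P : Measure Ω) (X : Fin n → ℕ → Ω → ℝ)
    (U : ℕ → Ω → ℝ) : Prop where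
  prob : IsProbabilityMeasure P
  bounded : ∀ i, ∀ᵐ x ∂(ν i), x ∈ Set.Icc (0 : ℝ) 1
  measurable_X : ∀ i m, Measurable (X i m)
  measurable_U : ∀ m, Measurable (U m)
  law_X : ∀ i m, P.map (X i m) = ν i
  law_U : ∀ m, P.map (U m) = volume.restrict (Set.Icc (0 : ℝ) 1)
  indep : iIndepFun
    (Sum.elim (fun q : Fin n × ℕ => X q.1 q.2) U : (Fin n × ℕ) ⊕ ℕ → Ω → ℝ) P

namespace IsModel

variable {ν : Fin n → Measure ℝ} {P : Measure Ω} {X : Fin n → ℕ → Ω → ℝ} {U : ℕ → Ω → ℝ}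

section Hoeffding

lemma iIndepFun_X (H : IsModel ν P X U) (i : Fin n) : iIndepFun (fun m => X i m) P :=
  H.indep.precomp (g := fun m : ℕ => (Sum.inl (i, m) : (Fin n × ℕ) ⊕ ℕ))
    (fun a b h => by simpa using h)

lemma integral_X (H : IsModel ν P X U) (i : Fin n) (m : ℕ) : ∫ ω, X i m ω ∂P = ∫ x, x ∂(ν i) := by
  rw [← H.law_X i m, integral_map (H.measurable_X i m).aemeasurable]
  exact aestronglyMeasurable_id

/-- Hoeffding's lemma: on an interval of length 1 the variance proxy is (1/2)². -/
lemma hasSubgaussianMGF (H : IsModel ν P X U) (i : Fin n) (m : ℕ) :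
    HasSubgaussianMGF (fun ω => X i m ω - ∫ x, x ∂(ν i)) (1 / 4) P := by
  have := H.prob
  have hb : ∀ᵐ ω ∂P, X i m ω ∈ Set.Icc (0 : ℝ) 1 := by
    have h := H.bounded i
    rw [← H.law_X i m] at h
    exact ae_of_ae_map (H.measurable_X i m).aemeasurable h
  have h := hasSubgaussianMGF_of_mem_Icc (H.measurable_X i m).aemeasurable hb
  rw [H.integral_X] at h
  convert h using 1
  rw [sub_zero, nnnorm_one]
  norm_num

lemma measure_sum_ge_le (H : IsModel ν P X U) (i : Fin n) (N : ℕ) {y : ℝ} (hy : 0 ≤ y) :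
    P {ω | N * ((∫ x, x ∂(ν i)) + y) ≤ ∑ m ∈ Finset.range N, X i m ω}
      ≤ ENNReal.ofReal (Real.exp (-2 * N * y ^ 2)) := by
  have := H.prob
  rcases Nat.eq_zero_or_pos N with rfl | hN
  · simp
  have hind := (H.iIndepFun_X i).comp (fun _ x => x - ∫ x, x ∂(ν i))
    (fun _ => measurable_id.sub_const _)
  have h := HasSubgaussianMGF.measure_sum_range_ge_le_of_iIndepFun hind (n := N)
    (fun m _ => H.hasSubgaussianMGF i m) (ε := N * y) (by positivity)
  rw [← ofReal_measureReal]
  refine ENNReal.ofReal_le_ofReal ?_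
  convert h using 2
  · ext ω
    simp only [Function.comp, Finset.sum_sub_distrib, Finset.sum_const, Finset.card_range,
      nsmul_eq_mul, Set.mem_ofPred_eq]
    constructor <;> intro h <;> linarith
  · have : (N : ℝ) ≠ 0 := by positivity
    push_cast
    field_simp
    norm_num [mul_comm]

lemma measure_sum_le_le (H : IsModel ν P X U) (i : Fin n) (N : ℕ) {y : ℝ} (hy : 0 ≤ y) :
    P {ω | ∑ m ∈ Finset.range N, X i m ω ≤ N * ((∫ x, x ∂(ν i)) - y)}
      ≤ ENNReal.ofReal (Real.exp (-2 * N * y ^ 2)) := by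
  have := H.prob
  rcases Nat.eq_zero_or_pos N with rfl | hN
  · simp
  have hind := (H.iIndepFun_X i).comp (fun _ x => -(x - ∫ x, x ∂(ν i)))
    (fun _ => (measurable_id.sub_const _).neg)
  have h := HasSubgaussianMGF.measure_sum_range_ge_le_of_iIndepFun hind (n := N)
    (fun m _ => (H.hasSubgaussianMGF i m).neg) (ε := N * y) (by positivity)
  rw [← ofReal_measureReal]
  refine ENNReal.ofReal_le_ofReal ?_
  convert h using 2
  · ext ω
    simp only [Function.comp, Finset.sum_sub_distrib, Finset.sum_const, Finset.card_range,
      nsmul_eq_mul, Set.mem_ofPred_eq, Finset.sum_neg_distrib]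
    constructor <;> intro h <;> linarith
  · have : (N : ℝ) ≠ 0 := by positivity
    push_cast
    field_simp
    norm_num [mul_comm]

end Hoeffding

end IsModel

lemma Params.s_pos (p : Params) {l : ℕ} (hl : 1 ≤ l) : 0 < p.s l :=
  lt_of_le_of_lt (Nat.zero_le _) (p.s_strictMono hl)

namespace IsModel

variable {ν : Fin n → Measure ℝ} {P : Measure Ω} {X : Fin n → ℕ → Ω → ℝ} {U : ℕ → Ω → ℝ}

lemma measure_avg_ge_le (H : IsModel ν P X U) (p : Params) (i : Fin n) {l : ℕ} (hl : 1 ≤ l)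
    {y : ℝ} (hy : 0 ≤ y) :
    P {ω | (∫ x, x ∂(ν i)) + y ≤ p.avg (fun m => X i m ω) l}
      ≤ ENNReal.ofReal (Real.exp (-2 * p.s l * y ^ 2)) := by
  convert H.measure_sum_ge_le i (p.s l) hy using 4
  rw [avg, le_div_iff₀' (by exact_mod_cast p.s_pos hl)]

lemma measure_avg_le_le (H : IsModel ν P X U) (p : Params) (i : Fin n) {l : ℕ} (hl : 1 ≤ l)
    {y : ℝ} (hy : 0 ≤ y) :
    P {ω | p.avg (fun m => X i m ω) l ≤ (∫ x, x ∂(ν i)) - y}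
      ≤ ENNReal.ofReal (Real.exp (-2 * p.s l * y ^ 2)) := by
  convert H.measure_sum_le_le i (p.s l) hy using 4
  rw [avg, div_le_iff₀' (by exact_mod_cast p.s_pos hl)]

end IsModel

/-! ### Measurability -/

instance : MeasurableSpace (Finset (Fin n)) := ⊤

instance : DiscreteMeasurableSpace (Finset (Fin n)) := ⟨fun _ => trivial⟩

instance : MeasurableSpace (State n) :=
  MeasurableSpace.comap (fun st => (st.est, (st.A, st.j))) inferInstance

lemma measurable_tuple : Measurable fun st : State n => (st.est, (st.A, st.j)) :=
  comap_measurable _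

lemma measurable_state_mk {Y : Type*} {_ : MeasurableSpace Y} {A : Y → Finset (Fin n)}
    {est : Y → Fin n → ℝ} {j : Y → ℕ} (hA : Measurable A) (hest : Measurable est)
    (hj : Measurable j) : Measurable fun y => (⟨A y, est y, j y⟩ : State n) := by
  rw [measurable_comap_iff]
  exact hest.prodMk (hA.prodMk hj)

/-- Measurability of a function of a state and a parameter can be checked for a fixed set of arms
and a fixed counter. -/
lemma measurable_of_state_prod {Y Z : Type*} [MeasurableSpace Y] [MeasurableSpace Z]
    {f : State n × Y → Z}
    (h : ∀ A j, Measurable fun q : (Fin n → ℝ) × Y => f (⟨A, q.1, j⟩, q.2)) : Measurable f := by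
  have h1 : Measurable fun q : ((Fin n → ℝ) × Y) × (Finset (Fin n) × ℕ) =>
      f (⟨q.2.1, q.1.1, q.2.2⟩, q.1.2) :=
    measurable_from_prod_countable_left (fun y => h y.1 y.2)
  have h2 : Measurable fun q : State n × Y => ((q.1.est, q.2), (q.1.A, q.1.j)) :=
    ((measurable_tuple.comp measurable_fst).fst.prodMk measurable_snd).prodMk
      (measurable_tuple.comp measurable_fst).snd
  exact h1.comp h2

/-- Each fibre is cut out by finitely many comparisons between estimates. The tie rule acts on a
finite discrete space afterwards, so it may be arbitrary. -/
lemma measurable_argmin (A : Finset (Fin n)) (j : ℕ) :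
    Measurable fun est : Fin n → ℝ => (⟨A, est, j⟩ : State n).argmin := by
  classical
  refine measurable_to_countable' fun S => ?_
  have : (fun est : Fin n → ℝ => (⟨A, est, j⟩ : State n).argmin) ⁻¹' {S} =
      ⋂ a : Fin n, {est | a ∈ S ↔ a ∈ A ∧ ∀ b ∈ A, est a ≤ est b} := by
    ext est
    simp only [State.argmin, Set.mem_preimage, Set.mem_singleton_iff, Set.mem_iInter,
      Set.mem_ofPred_eq, Finset.ext_iff, Finset.mem_filter]
    exact forall_congr' fun a => Iff.comm
  rw [this]
  refine MeasurableSet.iInter fun a => ?_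
  refine measurableSet_setOfPred.mpr ?_
  refine Measurable.iff measurable_const (measurable_const.and ?_)
  refine Measurable.forall fun b => Measurable.imp measurable_const ?_
  exact measurableSet_setOfPred.mp (measurableSet_le (measurable_pi_apply a) (measurable_pi_apply b))

/-- Measurability of a function of the estimates and of the selected arm can be checked for a fixed
arm. -/
lemma measurable_of_top {Y Z : Type*} [MeasurableSpace Y] [MeasurableSpace Z]
    (tie : Finset (Fin n) → Fin n) (A : Finset (Fin n)) (j : ℕ)
    {f : (Fin n → ℝ) × Y → Fin n → Z} (h : ∀ a, Measurable fun q => f q a) :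
    Measurable fun q : (Fin n → ℝ) × Y => f q (tie (⟨A, q.1, j⟩ : State n).argmin) := by
  have h1 : Measurable fun q : ((Fin n → ℝ) × Y) × Fin n => f q.1 q.2 :=
    measurable_from_prod_countable_left h
  have h2 : Measurable fun q : (Fin n → ℝ) × Y =>
      (q, tie (⟨A, q.1, j⟩ : State n).argmin) :=
    measurable_id.prodMk ((measurable_of_countable tie).comp
      ((measurable_argmin A j).comp measurable_fst))
  exact h1.comp h2

lemma measurable_avg (p : Params) (l : ℕ) : Measurable fun x : ℕ → ℝ => p.avg x l :=
  (Finset.measurable_sum _ fun r _ => measurable_pi_apply r).div_const _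

lemma measurableSet_accepts (p : Params) (j : ℕ) :
    MeasurableSet {q : ℝ × (ℕ → ℝ) | p.Accepts q.1 j q.2} := by
  have : {q : ℝ × (ℕ → ℝ) | p.Accepts q.1 j q.2} =
      ⋂ l ∈ Finset.Icc 1 (p.lastRound j), {q : ℝ × (ℕ → ℝ) | q.1 ≤ p.avg q.2 l} := by
    ext q
    simp [Params.Accepts]
  rw [this]
  exact Finset.measurableSet_biInter _ fun l _ =>
    measurableSet_le measurable_fst ((measurable_avg p l).comp measurable_snd)

lemma measurable_pullBound (p : Params) (j : ℕ) :
    Measurable fun q : ℝ × (ℕ → ℝ) => p.pullBound q.1 j q.2 := by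
  refine Measurable.const_add (Finset.measurable_sum _ fun l _ => ?_) _
  exact Measurable.ite (measurableSet_le measurable_fst ((measurable_avg p l).comp measurable_snd))
    measurable_const measurable_const

lemma measurable_threshold_fixed (p : Params) (tie : Finset (Fin n) → Fin n)
    (A : Finset (Fin n)) (j : ℕ) :
    Measurable fun q : (Fin n → ℝ) × ((ℕ → ℝ) × ℝ) =>
      (threshold p tie (⟨A, q.1, j⟩ : State n) q.2.2, q.2.1) := by
  refine Measurable.prodMk (Measurable.add ?_ ?_) measurable_snd.fst
  · exact measurable_of_top tie A j (f := fun q a => q.1 a)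
      (fun a => (measurable_pi_apply a).comp measurable_fst)
  · exact Measurable.ite (measurableSet_lt measurable_snd.snd
      (measurable_const (a := 1 / (Real.log (j : ℝ) + 1))))
      measurable_const measurable_const

lemma measurable_stepState (p : Params) (tie : Finset (Fin n) → Fin n) (i : Fin n) :
    Measurable fun q : State n × ((ℕ → ℝ) × ℝ) => stepState p tie i q.1 q.2.1 q.2.2 := by
  classical
  refine measurable_of_state_prod fun A j => ?_
  refine Measurable.ite ((measurable_threshold_fixed p tie A j) (measurableSet_accepts p j)) ?_ ?_
  · refine measurable_state_mk ?_ ?_ (measurable_const (a := 1))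
    · exact measurable_of_top tie A j (f := fun q a => insert i (A.erase a))
        (fun a => measurable_const)
    · exact measurable_pi_lambda _ fun a => by
        by_cases h : a = i
        · subst h
          simpa [Function.comp_def] using (measurable_avg p (p.lastRound j)).comp measurable_snd.fst
        · simpa [h, Function.comp_def] using (measurable_pi_apply a).comp measurable_fst
  · exact measurable_state_mk measurable_const measurable_fst (measurable_const (a := j + 1))

lemma measurable_pullCost (p : Params) (tie : Finset (Fin n) → Fin n) (i : Fin n) :
    Measurable fun q : State n × ((ℕ → ℝ) × ℝ) => pullCost p tie i q.1 q.2.1 q.2.2 := by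
  refine measurable_of_state_prod fun A j => ?_
  exact (measurable_of_countable (fun N : ℕ => (N : ℝ≥0∞))).comp
    ((measurable_pullBound p j).comp (measurable_threshold_fixed p tie A j))

/-! ### The potential method -/

namespace IsModel

variable {ν : Fin n → Measure ℝ} {P : Measure Ω} {X : Fin n → ℕ → Ω → ℝ} {U : ℕ → Ω → ℝ}

/-- The σ-algebra generated by the rewards and the seeds in `S`. -/
abbrev sigma (X : Fin n → ℕ → Ω → ℝ) (U : ℕ → Ω → ℝ) (S : Set ((Fin n × ℕ) ⊕ ℕ)) :
    MeasurableSpace Ω :=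
  ⨆ s ∈ S, MeasurableSpace.comap (Sum.elim (fun q : Fin n × ℕ => X q.1 q.2) U s) inferInstance

omit [MeasurableSpace Ω] in
lemma sigma_mono {S T : Set ((Fin n × ℕ) ⊕ ℕ)} (h : S ⊆ T) : sigma X U S ≤ sigma X U T :=
  biSup_mono h

lemma sigma_le (H : IsModel ν P X U) (S : Set ((Fin n × ℕ) ⊕ ℕ)) : sigma X U S ≤ ‹_› := by
  refine iSup₂_le fun s _ => ?_
  rcases s with q | m
  · exact (H.measurable_X q.1 q.2).comap_le
  · exact (H.measurable_U m).comap_le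

omit [MeasurableSpace Ω] in
lemma measurable_sigma {S : Set ((Fin n × ℕ) ⊕ ℕ)} {s : (Fin n × ℕ) ⊕ ℕ} (hs : s ∈ S) :
    Measurable[sigma X U S] (Sum.elim (fun q : Fin n × ℕ => X q.1 q.2) U s) :=
  (comap_measurable _).mono (le_biSup (fun s => MeasurableSpace.comap
    (Sum.elim (fun q : Fin n × ℕ => X q.1 q.2) U s) inferInstance) hs) le_rfl

omit [MeasurableSpace Ω] in
lemma measurable_path {S : Set ((Fin n × ℕ) ⊕ ℕ)} {a : Fin n} (hs : ∀ r, Sum.inl (a, r) ∈ S) :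
    Measurable[sigma X U S] fun ω r => X a r ω :=
  @measurable_pi_lambda _ _ _ (sigma X U S) _ _ fun r => measurable_sigma (hs r)

omit [MeasurableSpace Ω] in
lemma measurable_data {S : Set ((Fin n × ℕ) ⊕ ℕ)} {a : Fin n} {m : ℕ}
    (hs : ∀ r, Sum.inl (a, r) ∈ S) (hm : Sum.inr m ∈ S) :
    Measurable[sigma X U S] fun ω => ((fun r => X a r ω), U m ω) :=
  (measurable_path hs).prodMk (measurable_sigma hm)

lemma indepFun_of_disjoint {Y Z : Type*} [MeasurableSpace Y] [MeasurableSpace Z]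
    (H : IsModel ν P X U) {S T : Set ((Fin n × ℕ) ⊕ ℕ)}
    (hST : Disjoint S T) {f : Ω → Y} {g : Ω → Z} (hf : Measurable[sigma X U S] f)
    (hg : Measurable[sigma X U T] g) : IndepFun f g P := by
  have h := indep_iSup_of_disjoint (m := fun s => MeasurableSpace.comap
    (Sum.elim (fun q : Fin n × ℕ => X q.1 q.2) U s) inferInstance) (fun s => by
      rcases s with q | m
      · exact (H.measurable_X q.1 q.2).comap_le
      · exact (H.measurable_U m).comap_le) H.indep.iIndep hST
  exact indep_of_indep_of_le_left (indep_of_indep_of_le_right h hg.comap_le) hf.comap_le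

/-- Fubini for the joint law: the past `f` can be frozen while the fresh data `g` is averaged. -/
lemma lintegral_of_indepFun {Y Z : Type*} [MeasurableSpace Y] [MeasurableSpace Z]
    (H : IsModel ν P X U) {f : Ω → Y} {g : Ω → Z} (hf : Measurable f) (hg : Measurable g)
    (h : IndepFun f g P) {F : Y → Z → ℝ≥0∞} (hF : Measurable fun q : Y × Z => F q.1 q.2) :
    ∫⁻ ω, F (f ω) (g ω) ∂P = ∫⁻ ω, ∫⁻ ω', F (f ω) (g ω') ∂P ∂P := by
  have := H.prob
  have hm := (indepFun_iff_map_prod_eq_prod_map_map hf.aemeasurable hg.aemeasurable).mp h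
  calc ∫⁻ ω, F (f ω) (g ω) ∂P
      = ∫⁻ q, F q.1 q.2 ∂(P.map fun ω => (f ω, g ω)) := by
        rw [lintegral_map hF (hf.prodMk hg)]
    _ = ∫⁻ y, ∫⁻ z, F y z ∂(P.map g) ∂(P.map f) := by
        have := Measure.isProbabilityMeasure_map (μ := P) hf.aemeasurable
        have := Measure.isProbabilityMeasure_map (μ := P) hg.aemeasurable
        rw [hm, lintegral_prod _ hF.aemeasurable]
    _ = _ := by
        have := Measure.isProbabilityMeasure_map (μ := P) hg.aemeasurable
        rw [lintegral_map (Measurable.lintegral_prod_right' hF) hf]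
        refine lintegral_congr fun ω => ?_
        exact lintegral_map (hF.comp measurable_prodMk_left) hg

end IsModel

/-- The states that can occur when the arms in `l` are still to come. -/
structure State.Ready (p : Params) (st : State n) (l : List (Fin n)) : Prop where
  card : st.A.card = p.k
  one_le_j : 1 ≤ st.j
  notMem : ∀ a ∈ l, a ∉ st.A

lemma State.argmin_nonempty {st : State n} (h : st.A.Nonempty) : st.argmin.Nonempty := by
  obtain ⟨a, ha, hmin⟩ := st.A.exists_min_image st.est h
  exact ⟨a, Finset.mem_filter.mpr ⟨ha, hmin⟩⟩

lemma State.Ready.nonempty {p : Params} {st : State n} {l : List (Fin n)} (h : st.Ready p l) :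
    st.A.Nonempty := by
  rw [← Finset.card_pos, h.card]
  exact p.one_le_k

lemma State.Ready.top_mem {p : Params} {st : State n} {l : List (Fin n)} (h : st.Ready p l)
    {tie : Finset (Fin n) → Fin n} (htie : ∀ S : Finset (Fin n), S.Nonempty → tie S ∈ S) :
    tie st.argmin ∈ st.A ∧ ∀ b ∈ st.A, st.est (tie st.argmin) ≤ st.est b :=
  Finset.mem_filter.mp (htie _ (State.argmin_nonempty h.nonempty))

lemma State.Ready.step {p : Params} {st : State n} {a : Fin n} {l : List (Fin n)}
    (h : st.Ready p (a :: l)) (hl : (a :: l).Nodup)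
    {tie : Finset (Fin n) → Fin n} (htie : ∀ S : Finset (Fin n), S.Nonempty → tie S ∈ S)
    (x : ℕ → ℝ) (u : ℝ) : (stepState p tie a st x u).Ready p l := by
  have htop := (h.top_mem htie).1
  unfold stepState
  split_ifs
  · refine ⟨?_, le_rfl, ?_⟩
    · rw [Finset.card_insert_of_notMem
        (fun h' => h.notMem a (by simp) (Finset.mem_of_mem_erase h')), Finset.card_erase_add_one htop]
      exact h.card
    · intro b hb hb'
      rcases Finset.mem_insert.mp hb' with rfl | h'
      · exact (List.nodup_cons.mp hl).1 hb
      · exact h.notMem b (by simp [hb]) (Finset.mem_of_mem_erase h')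
  · exact ⟨h.card, Nat.le_add_left 1 _, fun b hb => h.notMem b (by simp [hb])⟩

namespace IsModel

variable {ν : Fin n → Measure ℝ} {P : Measure Ω} {X : Fin n → ℕ → Ω → ℝ} {U : ℕ → Ω → ℝ}

/-- Induction on the arms still to come. `S` lists the rewards and seeds on which the current state
may depend; the row of the next arm and the seed `m` lie outside it, so `hstep`, valid for a frozen
state, can be integrated over the past, and the potentials telescope. `B` is the amortized allowance
per arm. -/
theorem lintegral_runCost_le (H : IsModel ν P X U) (p : Params) {tie : Finset (Fin n) → Fin n}
    (htie : ∀ S : Finset (Fin n), S.Nonempty → tie S ∈ S)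
    {cost : Fin n → State n → (ℕ → ℝ) → ℝ → ℝ≥0∞}
    (hcost : ∀ i, Measurable fun q : State n × ((ℕ → ℝ) × ℝ) => cost i q.1 q.2.1 q.2.2)
    {Φ : State n → ℝ≥0∞} (hΦ : Measurable Φ) (B : ℝ≥0∞)
    (hstep : ∀ (a : Fin n) (l : List (Fin n)) (st : State n) (m : ℕ), (a :: l).Nodup →
      st.Ready p (a :: l) → ∫⁻ ω, (cost a st (fun r => X a r ω) (U m ω)
        + Φ (stepState p tie a st (fun r => X a r ω) (U m ω))) ∂P ≤ Φ st + B)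
    (l : List (Fin n)) (hl : l.Nodup) (st : Ω → State n) (m : ℕ) (S : Set ((Fin n × ℕ) ⊕ ℕ))
    (hst : Measurable[sigma X U S] st) (hready : ∀ ω, (st ω).Ready p l)
    (hS : ∀ a ∈ l, ∀ r, Sum.inl (a, r) ∉ S) (hS' : ∀ r ≥ m, Sum.inr r ∉ S) :
    (Measurable fun ω => runCost p tie cost (fun i r => X i r ω) (fun r => U r ω) l (st ω) m) ∧
    ∫⁻ ω, runCost p tie cost (fun i r => X i r ω) (fun r => U r ω) l (st ω) m ∂P
      ≤ ∫⁻ ω, Φ (st ω) ∂P + l.length * B := by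
  have := H.prob
  induction l generalizing st m S with
  | nil => simp [runCost]
  | cons a l ih =>
    -- The fresh data of this step; the next state depends on `S ∪ T`.
    set T : Set ((Fin n × ℕ) ⊕ ℕ) := {s | (∃ r, s = Sum.inl (a, r)) ∨ s = Sum.inr m} with hT
    have hdata : Measurable[sigma X U T] fun ω => ((fun r => X a r ω), U m ω) :=
      measurable_data (fun r => Or.inl ⟨r, rfl⟩) (Or.inr rfl)
    have hdisj : Disjoint S T := by
      rw [Set.disjoint_left]
      rintro s hs (⟨r, rfl⟩ | rfl)
      · exact hS a (by simp) r hs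
      · exact hS' m le_rfl hs
    have hst0 : Measurable st := hst.mono (H.sigma_le S) le_rfl
    have hdata0 := hdata.mono (H.sigma_le T) le_rfl
    have hpair : Measurable[sigma X U (S ∪ T)] fun ω => (st ω, ((fun r => X a r ω), U m ω)) :=
      (hst.mono (sigma_mono Set.subset_union_left) le_rfl).prodMk
        (hdata.mono (sigma_mono Set.subset_union_right) le_rfl)
    have hnext : Measurable[sigma X U (S ∪ T)]
        fun ω => stepState p tie a (st ω) (fun r => X a r ω) (U m ω) :=
      @Measurable.comp Ω (State n × ((ℕ → ℝ) × ℝ)) (State n) (sigma X U (S ∪ T)) _ _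
        (fun q => stepState p tie a q.1 q.2.1 q.2.2)
        (fun ω => (st ω, ((fun r => X a r ω), U m ω))) (measurable_stepState p tie a) hpair
    obtain ⟨ih1, ih2⟩ := ih (List.nodup_cons.mp hl).2
      (fun ω => stepState p tie a (st ω) (fun r => X a r ω) (U m ω)) (m + 1) (S ∪ T)
      hnext
      (fun ω => (hready ω).step hl htie _ _)
      (by
        rintro b hb r (h | ⟨⟨r', h⟩ | h⟩)
        · exact hS b (by simp [hb]) r h
        · simp only [Sum.inl.injEq, Prod.mk.injEq] at h
          exact (List.nodup_cons.mp hl).1 (h.1 ▸ hb)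
        · simp at h)
      (by
        rintro r hr (h | ⟨⟨r', h⟩ | h⟩)
        · exact hS' r (by omega) h
        · simp at h
        · simp only [Sum.inr.injEq] at h
          omega)
    have hc : Measurable fun ω => cost a (st ω) (fun r => X a r ω) (U m ω) :=
      (hcost a).comp (hst0.prodMk hdata0)
    refine ⟨hc.add ih1, ?_⟩
    simp only [runCost]
    rw [lintegral_add_left hc]
    have hF : Measurable fun q : State n × ((ℕ → ℝ) × ℝ) =>
        cost a q.1 q.2.1 q.2.2 + Φ (stepState p tie a q.1 q.2.1 q.2.2) :=
      (hcost a).add (hΦ.comp (measurable_stepState p tie a))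
    calc _ ≤ ∫⁻ ω, cost a (st ω) (fun r => X a r ω) (U m ω) ∂P +
          (∫⁻ ω, Φ (stepState p tie a (st ω) (fun r => X a r ω) (U m ω)) ∂P + l.length * B) := by
          gcongr
      _ = ∫⁻ ω, (cost a (st ω) (fun r => X a r ω) (U m ω) +
          Φ (stepState p tie a (st ω) (fun r => X a r ω) (U m ω))) ∂P + l.length * B := by
          rw [lintegral_add_left hc, add_assoc]
      _ = ∫⁻ ω, ∫⁻ ω', (cost a (st ω) (fun r => X a r ω') (U m ω') +
          Φ (stepState p tie a (st ω) (fun r => X a r ω') (U m ω'))) ∂P ∂P + l.length * B := by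
          congr 1
          exact H.lintegral_of_indepFun hst0 hdata0 (H.indepFun_of_disjoint hdisj hst hdata)
            (F := fun s y => cost a s y.1 y.2 + Φ (stepState p tie a s y.1 y.2)) hF
      _ ≤ ∫⁻ ω, (Φ (st ω) + B) ∂P + l.length * B := by
          gcongr with ω
          exact hstep a l (st ω) m hl (hready ω)
      _ = _ := by
          rw [lintegral_add_right _ measurable_const]
          simp only [lintegral_const, measure_univ, mul_one, List.length_cons, Nat.cast_add,
            Nat.cast_one]
          ring

end IsModel

end StreamingBandit

namespace StreamingBandit

open Params
open scoped ENNReal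

/-! ### Estimates for the parameters -/

namespace Params

variable (p : Params)

/-- `log (C k / δ)`. -/
noncomputable def logTerm : ℝ := Real.log (p.C * p.k / p.δ)

/-- `(16 / ε²) log (C k / δ)`. -/
noncomputable def base : ℝ := 16 / p.ε ^ 2 * p.logTerm

lemma one_le_natCast_k : (1 : ℝ) ≤ p.k := by exact_mod_cast p.one_le_k

lemma hundred_mul_k_le : 100 * (p.k : ℝ) ≤ p.C * p.k / p.δ := by
  rw [le_div_iff₀ p.δ_pos]
  have h1 := p.one_le_natCast_k
  have h2 := p.hundred_le_C
  nlinarith [mul_le_mul_of_nonneg_left p.δ_lt_one.le (by positivity : (0 : ℝ) ≤ 100 * p.k)]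

lemma div_pos : 0 < p.C * p.k / p.δ := by
  have := p.hundred_mul_k_le
  linarith [p.one_le_natCast_k]

lemma exp_neg_logTerm : Real.exp (-p.logTerm) = p.δ / (p.C * p.k) := by
  rw [Real.exp_neg, logTerm, Real.exp_log p.div_pos, inv_div]

lemma exp_neg_logTerm_le : Real.exp (-p.logTerm) ≤ 1 / 100 := by
  rw [Real.exp_neg, logTerm, Real.exp_log p.div_pos, one_div]
  exact inv_anti₀ (by norm_num) (by linarith [p.hundred_mul_k_le, p.one_le_natCast_k])

lemma four_le_logTerm : 4 ≤ p.logTerm := by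
  rw [logTerm, Real.le_log_iff_exp_le p.div_pos]
  have h1 : Real.exp 4 = Real.exp 1 ^ 4 := by rw [← Real.exp_nat_mul]; norm_num
  have h2 : Real.exp 1 ^ 4 ≤ 2.7182818286 ^ 4 :=
    pow_le_pow_left₀ (Real.exp_pos 1).le Real.exp_one_lt_d9.le 4
  rw [h1]
  refine h2.trans ?_
  have := p.hundred_mul_k_le
  have := p.one_le_natCast_k
  norm_num
  linarith

lemma one_le_base' : 1 ≤ p.base := p.one_le_base

lemma base_mul_sq : p.base * p.ε ^ 2 = 16 * p.logTerm := by
  have := p.ε_pos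
  unfold base
  field_simp

lemma le_s {l : ℕ} (hl : 1 ≤ l) : p.base * 2 ^ l ≤ p.s l := by
  rw [s, if_neg (by omega)]
  exact Nat.le_ceil _

lemma s_le {l : ℕ} (hl : 1 ≤ l) : (p.s l : ℝ) ≤ 2 * p.base * 2 ^ l := by
  have h1 := p.one_le_base'
  have h2 : (1 : ℝ) ≤ 2 ^ l := one_le_pow₀ (by norm_num)
  rw [s, if_neg (by omega)]
  have h3 : (⌈16 / p.ε ^ 2 * Real.log (p.C * p.k / p.δ) * 2 ^ l⌉₊ : ℝ) < p.base * 2 ^ l + 1 :=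
    Nat.ceil_lt_add_one (by have := p.one_le_base; positivity)
  nlinarith

lemma s_succ_le {l : ℕ} (hl : 1 ≤ l) : p.s (l + 1) ≤ 2 * p.s l := by
  have h := p.le_s hl
  rw [s, if_neg (by omega), Nat.ceil_le]
  push_cast
  unfold base logTerm at h
  rw [pow_succ (2 : ℝ) l]
  linarith

lemma tau_eq {j : ℕ} (hj : 1 ≤ j) :
    p.tau j = 32 / p.ε ^ 2 * (p.logTerm + 2 * Real.log j) := by
  have hj' : (0 : ℝ) < j := by exact_mod_cast hj
  have h : p.C * p.k * (j : ℝ) ^ 2 / p.δ = p.C * p.k / p.δ * (j : ℝ) ^ 2 := by ring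
  rw [tau, h, Real.log_mul p.div_pos.ne' (by positivity), Real.log_pow, logTerm]
  norm_num

/-- Unless the last round is the first, its predecessor satisfies `s ≤ tau j`, and one more round at
most doubles `s`. The factor `1 + log j` comes from L + 2 log j ≤ L (1 + log j), valid as L =
`logTerm` is at least 4. -/
lemma s_lastRound_le {j : ℕ} (hj : 1 ≤ j) :
    (p.s (p.lastRound j) : ℝ) ≤ 4 * p.base * (1 + Real.log j) := by
  have hb := p.one_le_base'
  have hlog : 0 ≤ Real.log j := Real.log_natCast_nonneg j
  rcases (p.one_le_lastRound j).eq_or_lt with h | h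
  · rw [← h]
    have := p.s_le le_rfl
    nlinarith
  · obtain ⟨r, hr⟩ : ∃ r, p.lastRound j = r + 1 := ⟨p.lastRound j - 1, by omega⟩
    have h1 : (p.s r : ℝ) ≤ p.tau j := p.s_le_tau (by omega) (by omega)
    have h2 : (p.s (r + 1) : ℝ) ≤ 2 * p.s r := by exact_mod_cast p.s_succ_le (by omega)
    have h3 : p.tau j ≤ 2 * p.base * (1 + Real.log j) := by
      rw [p.tau_eq hj]
      have h4 := p.four_le_logTerm
      have h5 : 0 < 32 / p.ε ^ 2 := by have := p.ε_pos; positivity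
      have : 2 * p.base * (1 + Real.log j)
          = 32 / p.ε ^ 2 * (p.logTerm * (1 + Real.log j)) := by unfold base; ring
      rw [this]
      refine mul_le_mul_of_nonneg_left ?_ h5.le
      nlinarith
    rw [hr]
    linarith

/-- As `base` · ε² = 16 `logTerm`, the exponent is at least `logTerm` · 2^l / 2, and 2l ≤ 2^l makes
the bound geometric in the round. -/
lemma exp_deviation_le {l : ℕ} (hl : 1 ≤ l) :
    Real.exp (-2 * p.s l * (p.ε / 8) ^ 2) ≤ Real.exp (-p.logTerm) ^ l := by
  rw [← Real.exp_nat_mul, Real.exp_le_exp]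
  have h1 := p.le_s hl
  have h2 := p.base_mul_sq
  have h3 := p.four_le_logTerm
  have h4 : (2 : ℝ) * l ≤ 2 ^ l := by
    obtain ⟨r, rfl⟩ : ∃ r, l = r + 1 := ⟨l - 1, by omega⟩
    have : r + 1 ≤ 2 ^ r := Nat.lt_two_pow_self
    have : (r : ℝ) + 1 ≤ 2 ^ r := by exact_mod_cast this
    push_cast
    rw [pow_succ]
    linarith
  have h5 : p.base * 2 ^ l * p.ε ^ 2 ≤ p.s l * p.ε ^ 2 :=
    mul_le_mul_of_nonneg_right h1 (by positivity)
  have h6 : p.base * 2 ^ l * p.ε ^ 2 = 16 * p.logTerm * 2 ^ l := by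
    rw [← h2]; ring
  nlinarith

lemma pullBound_le_s (θ : ℝ) (j : ℕ) (x : ℕ → ℝ) : p.pullBound θ j x ≤ p.s (p.lastRound j) := by
  have h1 : p.pullBound θ j x
      ≤ p.s 1 + ∑ l ∈ Finset.Ico 1 (p.lastRound j), (p.s (l + 1) - p.s l) := by
    refine Nat.add_le_add_left (Finset.sum_le_sum fun l _ => ?_) _
    split_ifs
    · exact le_rfl
    · exact Nat.zero_le _
  refine h1.trans ?_
  have h2 : ∀ d, p.s 1 + ∑ l ∈ Finset.Ico 1 (1 + d), (p.s (l + 1) - p.s l) = p.s (1 + d) := by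
    intro d
    induction d with
    | zero => simp
    | succ d ih =>
      rw [← add_assoc, Finset.sum_Ico_succ_top (by omega), ← add_assoc, ih]
      have := p.s_lt_s_succ (1 + d)
      omega
  have h3 := h2 (p.lastRound j - 1)
  have h4 : 1 + (p.lastRound j - 1) = p.lastRound j := by
    have := p.one_le_lastRound j
    omega
  rw [h4] at h3
  exact h3.le

end Params

/-! ### Probabilities and expectations for one arm -/

/-- Adding d to f on G keeps it below b. Only the indicator has to be measurable, so nothing is
needed of f. -/
lemma lintegral_le_of_drop {Ω : Type*} [MeasurableSpace Ω] {P : Measure Ω}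
    [IsProbabilityMeasure P] {f : Ω → ℝ≥0∞} {G : Set Ω} (hG : MeasurableSet G) {b d q : ℝ}
    (hd : 0 ≤ d) (hdb : d ≤ b) (hq : 0 ≤ q) (hq1 : q ≤ 1) (hqG : ENNReal.ofReal q ≤ P G)
    (hf : ∀ ω, f ω ≤ ENNReal.ofReal b) (hfG : ∀ ω ∈ G, f ω ≤ ENNReal.ofReal (b - d)) :
    ∫⁻ ω, f ω ∂P ≤ ENNReal.ofReal (b - d * q) := by
  have h1 : ∫⁻ ω, f ω ∂P + ENNReal.ofReal (d * q) ≤ ENNReal.ofReal b := by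
    calc ∫⁻ ω, f ω ∂P + ENNReal.ofReal (d * q)
        ≤ ∫⁻ ω, f ω ∂P + ENNReal.ofReal d * P G := by
          rw [ENNReal.ofReal_mul hd]; gcongr
      _ = ∫⁻ ω, (f ω + G.indicator (fun _ => ENNReal.ofReal d) ω) ∂P := by
          rw [lintegral_add_right _ (measurable_const.indicator hG), lintegral_indicator_const hG]
      _ ≤ ∫⁻ _, ENNReal.ofReal b ∂P := by
          refine lintegral_mono fun ω => ?_
          by_cases h : ω ∈ G
          · simp only [h, Set.indicator_of_mem]
            calc f ω + ENNReal.ofReal d ≤ ENNReal.ofReal (b - d) + ENNReal.ofReal d := by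
                  gcongr; exact hfG ω h
              _ = ENNReal.ofReal b := by
                  rw [← ENNReal.ofReal_add (by linarith) hd, sub_add_cancel]
          · simpa [h] using hf ω
      _ = ENNReal.ofReal b := by simp
  have h2 : ENNReal.ofReal b = ENNReal.ofReal (b - d * q) + ENNReal.ofReal (d * q) := by
    rw [← ENNReal.ofReal_add (by nlinarith) (by positivity), sub_add_cancel]
  rw [h2] at h1
  exact (ENNReal.add_le_add_iff_right ENNReal.ofReal_ne_top).mp h1

variable {n : ℕ} {Ω : Type u} [MeasurableSpace Ω]

namespace IsModel

variable {ν : Fin n → Measure ℝ} {P : Measure Ω} {X : Fin n → ℕ → Ω → ℝ} {U : ℕ → Ω → ℝ}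

/-- A union bound over all rounds: with D = exp(-`logTerm`), the failure probability D^(l+1) is at
most D / 2^l, and the series sums to 2D. -/
lemma measure_exists_avg_lt_le (H : IsModel ν P X U) (p : Params) (i : Fin n) :
    P {ω | ∃ l, 1 ≤ l ∧ p.avg (fun m => X i m ω) l < (∫ x, x ∂(ν i)) - p.ε / 8}
      ≤ ENNReal.ofReal (2 * (p.δ / (p.C * p.k))) := by
  have he := p.exp_neg_logTerm_le
  have he0 := Real.exp_pos (-p.logTerm)
  calc _ ≤ P (⋃ l : ℕ, {ω | p.avg (fun m => X i m ω) (l + 1) ≤ (∫ x, x ∂(ν i)) - p.ε / 8}) := by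
        refine measure_mono ?_
        rintro ω ⟨l, hl, h⟩
        refine Set.mem_iUnion.mpr ⟨l - 1, ?_⟩
        rw [Set.mem_ofPred_eq, Nat.sub_add_cancel hl]
        exact h.le
    _ ≤ ∑' l : ℕ, P {ω | p.avg (fun m => X i m ω) (l + 1) ≤ (∫ x, x ∂(ν i)) - p.ε / 8} :=
        measure_iUnion_le _
    _ ≤ ∑' l : ℕ, ENNReal.ofReal (p.δ / (p.C * p.k) * (1 / 2) ^ l) := by
        refine ENNReal.tsum_le_tsum fun l => ?_
        refine (H.measure_avg_le_le p i (by omega) (by linarith [p.ε_pos])).trans ?_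
        refine ENNReal.ofReal_le_ofReal ((p.exp_deviation_le (by omega)).trans ?_)
        rw [← p.exp_neg_logTerm, pow_succ, mul_comm]
        gcongr
        linarith
    _ = _ := by
        have h0 : 0 < p.δ / (p.C * p.k) := p.exp_neg_logTerm ▸ he0
        rw [← ENNReal.ofReal_tsum_of_nonneg (fun l => by positivity)
          (summable_geometric_two.mul_left _), tsum_mul_left, tsum_geometric_two, mul_comm]

lemma measurable_row (H : IsModel ν P X U) (i : Fin n) : Measurable fun ω m => X i m ω :=
  measurable_pi_lambda _ fun m => H.measurable_X i m

/-- The event that the averages of an arm are not much smaller than its mean. -/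
def noUnder (ν : Fin n → Measure ℝ) (X : Fin n → ℕ → Ω → ℝ) (p : Params) (i : Fin n) : Set Ω :=
  {ω | ∀ l, 1 ≤ l → (∫ x, x ∂(ν i)) - p.ε / 8 ≤ p.avg (fun m => X i m ω) l}

lemma measurableSet_paths (p : Params) (c : ℝ) :
    MeasurableSet {x : ℕ → ℝ | ∀ l, 1 ≤ l → c ≤ p.avg x l} := by
  simp only [Set.ofPred_forall]
  exact MeasurableSet.iInter fun l => MeasurableSet.iInter fun _ =>
    measurableSet_le measurable_const (measurable_avg p l)

lemma measurableSet_noUnder (H : IsModel ν P X U) (p : Params) (i : Fin n) :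
    MeasurableSet (noUnder ν X p i) :=
  H.measurable_row i (measurableSet_paths p _)

lemma measure_noUnder_compl_le (H : IsModel ν P X U) (p : Params) (i : Fin n) :
    P (noUnder ν X p i)ᶜ ≤ ENNReal.ofReal (2 * (p.δ / (p.C * p.k))) := by
  refine (measure_mono ?_).trans (H.measure_exists_avg_lt_le p i)
  intro ω hω
  simp only [noUnder, Set.mem_compl_iff, Set.mem_ofPred_eq, not_forall, not_le] at hω
  obtain ⟨l, hl, h⟩ := hω
  exact ⟨l, hl, h⟩

lemma half_le_measure_noUnder (H : IsModel ν P X U) (p : Params) (i : Fin n) :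
    ENNReal.ofReal (1 / 2) ≤ P (noUnder ν X p i) := by
  have := H.prob
  have h1 : P (noUnder ν X p i)ᶜ ≤ ENNReal.ofReal (1 / 2) := by
    refine (H.measure_noUnder_compl_le p i).trans (ENNReal.ofReal_le_ofReal ?_)
    rw [← p.exp_neg_logTerm]
    linarith [p.exp_neg_logTerm_le]
  have h2 : P (noUnder ν X p i) + P (noUnder ν X p i)ᶜ = 1 :=
    prob_add_prob_compl (H.measurableSet_noUnder p i)
  have h3 : ENNReal.ofReal (1 / 2) + ENNReal.ofReal (1 / 2) = 1 := by
    rw [← ENNReal.ofReal_add (by norm_num) (by norm_num)]; norm_num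
  rw [← h2] at h3
  by_contra h
  exact absurd h3 (ne_of_gt (ENNReal.add_lt_add_of_lt_of_le
    (ne_top_of_le_ne_top ENNReal.ofReal_ne_top h1) (not_le.mp h) h1))

lemma measure_coin (H : IsModel ν P X U) (m : ℕ) {q : ℝ} (hq1 : q ≤ 1) :
    P {ω | U m ω < q} = ENNReal.ofReal q := by
  have h : P {ω | U m ω < q} = (P.map (U m)) (Set.Iio q) := by
    rw [Measure.map_apply (H.measurable_U m) measurableSet_Iio]
    rfl
  rw [h, H.law_U, Measure.restrict_apply measurableSet_Iio]
  have : Set.Iio q ∩ Set.Icc (0 : ℝ) 1 = Set.Ico 0 q := by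
    ext x
    simp only [Set.mem_inter_iff, Set.mem_Iio, Set.mem_Icc, Set.mem_Ico]
    constructor
    · rintro ⟨h1, h2, -⟩; exact ⟨h2, h1⟩
    · rintro ⟨h1, h2⟩; exact ⟨h2, h1, by linarith⟩
  rw [this, Real.volume_Ico, sub_zero]

lemma half_le_measure_coin_noUnder (H : IsModel ν P X U) (p : Params) (i : Fin n) (m : ℕ) {q : ℝ}
    (hq0 : 0 ≤ q) (hq1 : q ≤ 1) :
    ENNReal.ofReal (q / 2) ≤ P ({ω | U m ω < q} ∩ noUnder ν X p i) := by
  have hind : IndepFun (U m) (fun ω r => X i r ω) P := by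
    refine H.indepFun_of_disjoint (S := {Sum.inr m}) (T := {s | ∃ r, s = Sum.inl (i, r)}) ?_
      (measurable_sigma (s := Sum.inr m) rfl) (measurable_path fun r => ⟨r, rfl⟩)
    rw [Set.disjoint_left]
    rintro s rfl ⟨r, h⟩
    simp at h
  have h := hind.measure_inter_preimage_eq_mul (Set.Iio q) _ measurableSet_Iio
    (measurableSet_paths p ((∫ x, x ∂(ν i)) - p.ε / 8))
  have h' : P ({ω | U m ω < q} ∩ noUnder ν X p i) = P {ω | U m ω < q} * P (noUnder ν X p i) := h
  rw [h', H.measure_coin m hq1, div_eq_mul_one_div, ENNReal.ofReal_mul hq0]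
  gcongr
  exact H.half_le_measure_noUnder p i

/-- Round l is passed with probability at most 4^(-l), while the following increment is at most 4
`base` · 2^l. The expected increments form a geometric series of total at most 4 `base`, and the
first round adds at most as much. -/
lemma lintegral_pullBound_le (H : IsModel ν P X U) (p : Params) (i : Fin n) (j : ℕ) {θ : ℝ}
    (hθ : (∫ x, x ∂(ν i)) + p.ε / 8 ≤ θ) :
    ∫⁻ ω, (p.pullBound θ j (fun m => X i m ω) : ℝ≥0∞) ∂P ≤ ENNReal.ofReal (8 * p.base) := by
  have := H.prob
  have hb := p.one_le_base'
  have hset : ∀ l, MeasurableSet {ω | θ ≤ p.avg (fun m => X i m ω) l} := fun l =>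
    measurableSet_le measurable_const ((measurable_avg p l).comp (H.measurable_row i))
  have hE : ∀ ω, (p.pullBound θ j (fun m => X i m ω) : ℝ≥0∞) = p.s 1 +
      ∑ l ∈ Finset.Ico 1 (p.lastRound j), {ω | θ ≤ p.avg (fun m => X i m ω) l}.indicator
        (fun _ => ((p.s (l + 1) - p.s l : ℕ) : ℝ≥0∞)) ω := by
    intro ω
    simp only [pullBound, Nat.cast_add, Nat.cast_sum, Set.indicator_apply, Set.mem_ofPred_eq]
    congr 1
    refine Finset.sum_congr rfl fun l _ => ?_
    split_ifs <;> simp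
  simp only [hE]
  rw [lintegral_add_left measurable_const,
    lintegral_finsetSum _ (fun l _ => measurable_const.indicator (hset l))]
  have hterm : ∀ l ∈ Finset.Ico 1 (p.lastRound j),
      ∫⁻ ω, {ω | θ ≤ p.avg (fun m => X i m ω) l}.indicator
        (fun _ => ((p.s (l + 1) - p.s l : ℕ) : ℝ≥0∞)) ω ∂P
        ≤ ENNReal.ofReal (4 * p.base * (1 / 2) ^ l) := by
    intro l hl
    have hl1 : 1 ≤ l := (Finset.mem_Ico.mp hl).1
    rw [lintegral_indicator_const (hset l)]
    calc _ ≤ ENNReal.ofReal (4 * p.base * 2 ^ l) * ENNReal.ofReal ((1 / 4) ^ l) := by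
          gcongr
          · rw [← ENNReal.ofReal_natCast]
            refine ENNReal.ofReal_le_ofReal ?_
            have h1 : ((p.s (l + 1) - p.s l : ℕ) : ℝ) ≤ p.s (l + 1) := by
              exact_mod_cast Nat.sub_le _ _
            have h2 := p.s_le (l := l + 1) (by omega)
            rw [pow_succ] at h2
            linarith
          · calc P {ω | θ ≤ p.avg (fun m => X i m ω) l}
                ≤ P {ω | (∫ x, x ∂(ν i)) + p.ε / 8 ≤ p.avg (fun m => X i m ω) l} :=
                  measure_mono fun ω h => hθ.trans h
              _ ≤ _ := H.measure_avg_ge_le p i hl1 (by linarith [p.ε_pos])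
              _ ≤ _ := by
                refine ENNReal.ofReal_le_ofReal ((p.exp_deviation_le hl1).trans ?_)
                have := p.exp_neg_logTerm_le
                gcongr
                linarith
      _ = _ := by
          rw [← ENNReal.ofReal_mul (by positivity), mul_assoc, ← mul_pow]
          norm_num
  calc _ ≤ ENNReal.ofReal (4 * p.base) +
        ∑ l ∈ Finset.Ico 1 (p.lastRound j), ENNReal.ofReal (4 * p.base * (1 / 2) ^ l) := by
        refine add_le_add ?_ (Finset.sum_le_sum hterm)
        rw [lintegral_const, measure_univ, mul_one, ← ENNReal.ofReal_natCast]
        refine ENNReal.ofReal_le_ofReal ?_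
        linarith [p.s_le le_rfl]
    _ ≤ _ := by
        rw [← ENNReal.ofReal_sum_of_nonneg (fun l _ => by positivity),
          ← ENNReal.ofReal_add (by positivity) (Finset.sum_nonneg fun l _ => by positivity)]
        refine ENNReal.ofReal_le_ofReal ?_
        rw [← Finset.mul_sum]
        have h1 : ∀ d, ∑ l ∈ Finset.Ico 1 (1 + d), ((1 : ℝ) / 2) ^ l = 1 - (1 / 2) ^ d := by
          intro d
          induction d with
          | zero => simp
          | succ d ih =>
            rw [← add_assoc, Finset.sum_Ico_succ_top (by omega), ih]
            ring
        have h2 := h1 (p.lastRound j - 1)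
        rw [show 1 + (p.lastRound j - 1) = p.lastRound j by
          have := p.one_le_lastRound j; omega] at h2
        rw [h2]
        have : (0 : ℝ) < (1 / 2) ^ (p.lastRound j - 1) := by positivity
        nlinarith

end IsModel

/-! ### The expected number of pulls -/

/-- The credit that is available at counter `j` for the next accepted arm. -/
noncomputable def credit (p : Params) (j : ℕ) : ℝ := 8 * p.base * (1 + Real.log j) ^ 2

lemma credit_mono (p : Params) {i j : ℕ} (hi : 1 ≤ i) (hij : i ≤ j) :
    credit p i ≤ credit p j := by
  have := p.one_le_base'
  have h1 : 0 ≤ Real.log i := Real.log_natCast_nonneg i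
  have h2 : Real.log i ≤ Real.log j :=
    Real.log_le_log (by exact_mod_cast hi) (by exact_mod_cast hij)
  unfold credit
  gcongr

/-- The logarithm grows by at most 1/j, and the two values of 1 + log add up to at most 4j; so the
squares differ by at most 4. -/
lemma credit_succ_le (p : Params) {j : ℕ} (hj : 1 ≤ j) :
    credit p (j + 1) ≤ credit p j + 32 * p.base := by
  have hb := p.one_le_base'
  have hj' : (1 : ℝ) ≤ j := by exact_mod_cast hj
  have h0 : 0 ≤ Real.log j := Real.log_natCast_nonneg j
  have h1 : Real.log (j + 1 : ℕ) ≤ Real.log j + 1 / j := by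
    have : Real.log ((j + 1 : ℕ) / (j : ℝ)) ≤ (j + 1 : ℕ) / (j : ℝ) - 1 :=
      Real.log_le_sub_one_of_pos (by positivity)
    rw [Real.log_div (by positivity) (by positivity)] at this
    have h : ((j + 1 : ℕ) : ℝ) / j - 1 = 1 / j := by push_cast; field_simp; ring
    linarith
  have h2 : Real.log (j + 1 : ℕ) ≤ j := by
    have := Real.log_le_sub_one_of_pos (show (0 : ℝ) < (j + 1 : ℕ) by positivity)
    push_cast at this ⊢
    linarith
  have h3 : Real.log j ≤ Real.log (j + 1 : ℕ) :=
    Real.log_le_log (by positivity) (by push_cast; linarith)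
  have h4 : (1 + Real.log (j + 1 : ℕ)) ^ 2 - (1 + Real.log j) ^ 2 ≤ 4 := by
    have : (1 + Real.log (j + 1 : ℕ)) ^ 2 - (1 + Real.log j) ^ 2
        = (Real.log (j + 1 : ℕ) - Real.log j) * (2 + Real.log (j + 1 : ℕ) + Real.log j) := by ring
    rw [this]
    calc _ ≤ 1 / (j : ℝ) * (4 * j) := by
          refine mul_le_mul (by linarith) (by linarith) (by linarith) (by positivity)
      _ = 4 := by field_simp
  unfold credit
  nlinarith

lemma stepState_j_le (p : Params) (tie : Finset (Fin n) → Fin n) (i : Fin n) (st : State n)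
    (x : ℕ → ℝ) (u : ℝ) :
    1 ≤ (stepState p tie i st x u).j ∧ (stepState p tie i st x u).j ≤ st.j + 1 := by
  unfold stepState
  split_ifs <;> simp

lemma coin_prob_mem {j : ℕ} : 0 < 1 / (Real.log j + 1) ∧ 1 / (Real.log j + 1) ≤ 1 := by
  have h0 : 0 ≤ Real.log j := Real.log_natCast_nonneg j
  refine ⟨by positivity, ?_⟩
  rw [div_le_one (by positivity)]
  linarith

namespace IsModel

variable {ν : Fin n → Measure ℝ} {P : Measure Ω} {X : Fin n → ℕ → Ω → ℝ} {U : ℕ → Ω → ℝ}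

/-- The mean is compared with the midpoint v + 3ε/8 of the two possible thresholds, v being the
smallest estimate. Below it, only the coin for ε/4 is dangerous, and its probability cancels the
factor 1 + log j of the worst case; the allowance is 4 + 8 + 32 = 44 times `base`. Above it, that
coin together with `noUnder` forces acceptance, and the released credit pays for the worst case. -/
lemma lintegral_pullCost_step_le (H : IsModel ν P X U) (p : Params)
    (tie : Finset (Fin n) → Fin n) (a : Fin n) (l : List (Fin n)) (st : State n) (m : ℕ)
    (hst : st.Ready p (a :: l)) :
    ∫⁻ ω, (pullCost p tie a st (fun r => X a r ω) (U m ω)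
        + ENNReal.ofReal (credit p (stepState p tie a st (fun r => X a r ω) (U m ω)).j)) ∂P
      ≤ ENNReal.ofReal (credit p st.j) + ENNReal.ofReal (44 * p.base) := by
  have := H.prob
  have hb := p.one_le_base'
  have hε := p.ε_pos
  have hj := hst.one_le_j
  have hlog : 0 ≤ Real.log st.j := Real.log_natCast_nonneg _
  have hcr := credit_succ_le p hj
  have hcr0 : 0 ≤ credit p st.j := by unfold credit; positivity
  have hworst : ∀ θ x, (p.pullBound θ st.j x : ℝ≥0∞)
      ≤ ENNReal.ofReal (4 * p.base * (1 + Real.log st.j)) := by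
    intro θ x
    rw [← ENNReal.ofReal_natCast]
    refine ENNReal.ofReal_le_ofReal (le_trans ?_ (p.s_lastRound_le hj))
    exact_mod_cast p.pullBound_le_s θ st.j x
  obtain ⟨hq0, hq1⟩ := coin_prob_mem (j := st.j)
  have hq : 1 / (Real.log st.j + 1) * (1 + Real.log st.j) = 1 := by
    field_simp; ring
  set q := 1 / (Real.log st.j + 1) with hqdef
  have hnext : ∀ x u, credit p (stepState p tie a st x u).j ≤ credit p (st.j + 1) := fun x u =>
    credit_mono p (stepState_j_le p tie a st x u).1 (stepState_j_le p tie a st x u).2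
  rw [← ENNReal.ofReal_add hcr0 (by positivity)]
  by_cases hm : (∫ x, x ∂(ν a)) ≤ st.est (tie st.argmin) + 3 * p.ε / 8
  · have hUset : MeasurableSet {ω | U m ω < q} :=
      measurableSet_lt (H.measurable_U m) measurable_const
    have hcost : ∀ ω, pullCost p tie a st (fun r => X a r ω) (U m ω) ≤
        {ω | U m ω < q}.indicator
          (fun _ => ENNReal.ofReal (4 * p.base * (1 + Real.log st.j))) ω +
        (p.pullBound (st.est (tie st.argmin) + p.ε / 2) st.j (fun r => X a r ω) : ℝ≥0∞) := by
      intro ω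
      by_cases h : U m ω < q
      · refine le_trans ?_ le_self_add
        simp only [Set.indicator_apply, Set.mem_ofPred_eq, h, if_true]
        exact hworst _ _
      · refine le_trans (le_of_eq ?_) le_add_self
        simp only [pullCost, threshold]
        rw [if_neg h]
    calc _ ≤ ∫⁻ ω, ({ω | U m ω < q}.indicator
          (fun _ => ENNReal.ofReal (4 * p.base * (1 + Real.log st.j))) ω +
          ((p.pullBound (st.est (tie st.argmin) + p.ε / 2) st.j (fun r => X a r ω) : ℝ≥0∞) +
          ENNReal.ofReal (credit p (st.j + 1)))) ∂P := by
          refine lintegral_mono fun ω => ?_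
          rw [← add_assoc]
          exact add_le_add (hcost ω) (ENNReal.ofReal_le_ofReal (hnext _ _))
      _ = ENNReal.ofReal (4 * p.base * (1 + Real.log st.j)) * ENNReal.ofReal q +
          (∫⁻ ω, (p.pullBound (st.est (tie st.argmin) + p.ε / 2) st.j
            (fun r => X a r ω) : ℝ≥0∞) ∂P + ENNReal.ofReal (credit p (st.j + 1))) := by
          rw [lintegral_add_left (measurable_const.indicator hUset),
            lintegral_indicator_const hUset, H.measure_coin m hq1,
            lintegral_add_right _ measurable_const, lintegral_const, measure_univ, mul_one]
      _ ≤ ENNReal.ofReal (4 * p.base) + (ENNReal.ofReal (8 * p.base) +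
          ENNReal.ofReal (credit p (st.j + 1))) := by
          rw [← ENNReal.ofReal_mul (by positivity), mul_assoc (4 * p.base), mul_comm _ q, hq,
            mul_one]
          exact add_le_add le_rfl
            (add_le_add (H.lintegral_pullBound_le p a st.j (by linarith)) le_rfl)
      _ ≤ _ := by
          have h1 : 0 ≤ credit p (st.j + 1) := by unfold credit; positivity
          rw [← ENNReal.ofReal_add (by positivity) h1, ← ENNReal.ofReal_add (by positivity)
            (by positivity)]
          exact ENNReal.ofReal_le_ofReal (by linarith)
  · have hdrop : ∫⁻ ω, ENNReal.ofReal
        (credit p (stepState p tie a st (fun r => X a r ω) (U m ω)).j) ∂P ≤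
        ENNReal.ofReal (credit p (st.j + 1) - (credit p (st.j + 1) - credit p 1) * (q / 2)) := by
      refine lintegral_le_of_drop (G := {ω | U m ω < q} ∩ noUnder ν X p a)
        ((measurableSet_lt (H.measurable_U m) measurable_const).inter
          (H.measurableSet_noUnder p a)) ?_ ?_ (by positivity) (by linarith)
        (H.half_le_measure_coin_noUnder p a m hq0.le hq1)
        (fun ω => ENNReal.ofReal_le_ofReal (hnext _ _)) ?_
      · linarith [credit_mono p le_rfl (show 1 ≤ st.j + 1 by omega)]
      · have : 0 ≤ credit p 1 := by unfold credit; positivity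
        linarith
      · rintro ω ⟨h1, h2⟩
        refine ENNReal.ofReal_le_ofReal ?_
        rw [sub_sub_cancel]
        unfold stepState
        rw [if_pos]
        intro r hr
        have := h2 r (Finset.mem_Icc.mp hr).1
        unfold threshold
        rw [if_pos (show U m ω < 1 / (Real.log st.j + 1) from h1)]
        linarith [not_le.mp hm]
    calc _ ≤ ∫⁻ ω, (ENNReal.ofReal (4 * p.base * (1 + Real.log st.j)) + ENNReal.ofReal
          (credit p (stepState p tie a st (fun r => X a r ω) (U m ω)).j)) ∂P := by
          refine lintegral_mono fun ω => ?_
          gcongr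
          exact hworst _ _
      _ ≤ ENNReal.ofReal (4 * p.base * (1 + Real.log st.j)) + ENNReal.ofReal
          (credit p (st.j + 1) - (credit p (st.j + 1) - credit p 1) * (q / 2)) := by
          rw [lintegral_add_left measurable_const, lintegral_const, measure_univ, mul_one]
          gcongr
      _ ≤ _ := by
          have h1 : credit p 1 ≤ credit p (st.j + 1) := credit_mono p le_rfl (by omega)
          have h2 : 0 ≤ credit p 1 := by unfold credit; positivity
          rw [← ENNReal.ofReal_add (by positivity) (by nlinarith)]
          refine ENNReal.ofReal_le_ofReal ?_
          have h3 : credit p st.j ≤ credit p (st.j + 1) := credit_mono p hj (by omega)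
          -- With x = 1 + log j this is 8 `base` (x² - 1) / (2x) = 4 `base` (x - 1/x), and 1/x ≤ 1.
          -- The square in `credit` is chosen for this.
          have h4 : (credit p st.j - credit p 1) * (q / 2)
              ≥ 4 * p.base * (1 + Real.log st.j) - 4 * p.base := by
            have : (credit p st.j - credit p 1) * (q / 2) =
                4 * p.base * ((1 + Real.log st.j) * (q * (1 + Real.log st.j)) - q) := by
              unfold credit
              simp only [Nat.cast_one, Real.log_one]
              ring
            rw [this, hq]
            nlinarith
          have h5 : (credit p st.j - credit p 1) * (q / 2)
              ≤ (credit p (st.j + 1) - credit p 1) * (q / 2) := by gcongr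
          linarith

end IsModel

end StreamingBandit

namespace StreamingBandit

open Params
open scoped ENNReal

/-! ### The potential of an estimated mean -/

/-- The potential of a stored estimate that exceeds the critical level by `u ε`. -/
noncomputable def armPotential (u : ℝ) : ℝ := 36 / (1 + Real.exp u)

/-- The weight of the counter when the smallest stored estimate exceeds the critical level by
`u ε`. -/
noncomputable def counterWeight (u : ℝ) : ℝ := Real.exp u / (1 + Real.exp u) ^ 2

lemma armPotential_nonneg (u : ℝ) : 0 ≤ armPotential u := by unfold armPotential; positivity

lemma armPotential_le (u : ℝ) : armPotential u ≤ 36 := by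
  unfold armPotential
  exact div_le_self (by norm_num) (by linarith [Real.exp_pos u])

lemma counterWeight_pos (u : ℝ) : 0 < counterWeight u := by unfold counterWeight; positivity

lemma counterWeight_le_one (u : ℝ) : counterWeight u ≤ 1 := by
  unfold counterWeight
  rw [div_le_one (by positivity)]
  nlinarith [Real.exp_pos u]

lemma armPotential_antitone : Antitone armPotential := by
  intro u v h
  unfold armPotential
  have := Real.exp_le_exp.mpr h
  gcongr

lemma armPotential_sub (u v : ℝ) : armPotential u - armPotential v
    = 36 * (Real.exp v - Real.exp u) / ((1 + Real.exp u) * (1 + Real.exp v)) := by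
  have h1 := Real.exp_pos u
  have h2 := Real.exp_pos v
  unfold armPotential
  field_simp
  ring

lemma nine_eighths_mul_exp_le {u v : ℝ} (h : u + 1 / 8 ≤ v) :
    9 / 8 * Real.exp u ≤ Real.exp v := by
  have h1 : Real.exp (u + 1 / 8) ≤ Real.exp v := Real.exp_le_exp.mpr h
  rw [Real.exp_add] at h1
  have h2 := Real.add_one_le_exp (1 / 8 : ℝ)
  nlinarith [Real.exp_pos u]

/-- The point z leaves a gap of at least 1/8 on one side. Across it the exponential grows by a
factor 9/8, so the difference is at least 1/9 of the larger value; the constant 36 in `armPotential`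
turns this into 4. -/
lemma four_mul_counterWeight_le {u v z : ℝ} (huv : u + 1 / 4 ≤ v) (huz : u ≤ z) (hzv : z ≤ v) :
    4 * counterWeight z ≤ armPotential u - armPotential v := by
  have hz := Real.exp_pos z
  rcases le_total (u + 1 / 8) z with h | h
  · have h1 : armPotential u - armPotential v ≥ armPotential u - armPotential z := by
      linarith [armPotential_antitone hzv]
    refine le_trans ?_ h1
    rw [armPotential_sub, counterWeight]
    have h2 := nine_eighths_mul_exp_le h
    have h3 : Real.exp u ≤ Real.exp z := Real.exp_le_exp.mpr huz
    have hu := Real.exp_pos u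
    calc 4 * (Real.exp z / (1 + Real.exp z) ^ 2)
        ≤ 36 * (Real.exp z - Real.exp u) / ((1 + Real.exp z) * (1 + Real.exp z)) := by
          rw [← mul_div_assoc, ← pow_two]
          exact div_le_div_of_nonneg_right (by linarith) (by positivity)
      _ ≤ _ := by
          have : 0 ≤ 36 * (Real.exp z - Real.exp u) := by linarith
          gcongr
  · have h1 : armPotential u - armPotential v ≥ armPotential z - armPotential v := by
      linarith [armPotential_antitone huz]
    refine le_trans ?_ h1
    rw [armPotential_sub, counterWeight]
    have h2 : 9 / 8 * Real.exp z ≤ Real.exp v := nine_eighths_mul_exp_le (by linarith)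
    have hv := Real.exp_pos v
    rw [← mul_div_assoc, div_le_div_iff₀ (by positivity) (by positivity)]
    have h3 : 4 * Real.exp z * (1 + Real.exp v) ≤
        36 * (Real.exp v - Real.exp z) * (1 + Real.exp z) := by nlinarith
    nlinarith

/-- The weight is at least exp(-|u|)/4, and 80Y - |u| ≥ 3 absorbs the factor 4. -/
lemma exp_le_counterWeight {u Y : ℝ} (hY : 3 / 8 ≤ Y) (h : |u| ≤ Y + 1) :
    Real.exp (-80 * Y) ≤ counterWeight u := by
  have h1 : Real.exp (-|u|) / 4 ≤ counterWeight u := by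
    unfold counterWeight
    rcases le_total 0 u with hu | hu
    · rw [abs_of_nonneg hu]
      have h2 : 1 ≤ Real.exp u := Real.one_le_exp hu
      rw [Real.exp_neg, div_le_div_iff₀ (by norm_num) (by positivity)]
      rw [inv_mul_le_iff₀ (Real.exp_pos u)]
      nlinarith
    · rw [abs_of_nonpos hu, neg_neg]
      have h2 : Real.exp u ≤ 1 := Real.exp_le_one_iff.mpr hu
      have h3 := Real.exp_pos u
      gcongr
      nlinarith
  refine le_trans ?_ h1
  have h4 : Real.exp (-80 * Y) * Real.exp 3 ≤ Real.exp (-|u|) := by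
    rw [← Real.exp_add, Real.exp_le_exp]
    linarith
  have h5 := Real.add_one_le_exp (3 : ℝ)
  nlinarith [Real.exp_pos (-80 * Y)]

/-- At negative arguments the logistic drop is comparable to the difference of exponentials: here at
least (7/8 - 1/2) exp(-q), over a denominator of at most 3, times 36. -/
lemma four_mul_exp_neg_le {u v q : ℝ} (hq : 0 ≤ q) (hu : u ≤ -q - 1) (hv : -q - 1 / 8 ≤ v) :
    4 * Real.exp (-q) ≤ armPotential u - armPotential v := by
  have h1 : armPotential (-q - 1) - armPotential (-q - 1 / 8) ≤ armPotential u - armPotential v :=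
    by linarith [armPotential_antitone hu, armPotential_antitone hv]
  refine le_trans ?_ h1
  rw [armPotential_sub]
  have e1 : Real.exp (-q - 1) ≤ Real.exp (-q) / 2 := by
    have := Real.add_one_le_exp (1 : ℝ)
    rw [Real.exp_sub]
    gcongr
    linarith
  have e2 : 7 / 8 * Real.exp (-q) ≤ Real.exp (-q - 1 / 8) := by
    have := Real.add_one_le_exp (-(1 / 8) : ℝ)
    rw [sub_eq_add_neg, Real.exp_add]
    nlinarith [Real.exp_pos (-q)]
  have e3 : Real.exp (-q - 1 / 8) ≤ Real.exp (-q) := Real.exp_le_exp.mpr (by linarith)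
  have e4 : Real.exp (-q) ≤ 1 := Real.exp_le_one_iff.mpr (by linarith)
  have e5 := Real.exp_pos (-q)
  have e6 := Real.exp_pos (-q - 1)
  have e7 := Real.exp_pos (-q - 1 / 8)
  rw [le_div_iff₀ (by positivity)]
  have e8 : (1 + Real.exp (-q - 1)) * (1 + Real.exp (-q - 1 / 8)) ≤ (3 / 2) * 2 := by
    gcongr <;> linarith
  nlinarith

/-- The condition `s > tau j` gives the exponent 64Y² (L + 2 log j), with L = `logTerm`. One copy of
L + 2 log j yields the first two factors; the remainder is at least 4 (64Y² - 1) ≥ 80Y, nearly sharp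
at Y = 3/8 (32 against 30). -/
lemma Params.exp_overestimate_le (p : Params) {j : ℕ} (hj : 1 ≤ j) {Y : ℝ} (hY : 3 / 8 ≤ Y) :
    Real.exp (-2 * p.s (p.lastRound j) * (p.ε * Y) ^ 2)
      ≤ p.δ / (p.C * p.k) * (1 / (j : ℝ) ^ 2) * Real.exp (-80 * Y) := by
  have hj' : (0 : ℝ) < j := by exact_mod_cast hj
  have h1 : (1 / (j : ℝ) ^ 2) = Real.exp (-(2 * Real.log j)) := by
    rw [Real.exp_neg, one_div, show 2 * Real.log j = Real.log ((j : ℝ) ^ 2) by simp,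
      Real.exp_log (by positivity)]
  rw [← p.exp_neg_logTerm, h1, ← Real.exp_add, ← Real.exp_add, Real.exp_le_exp]
  have h2 := (p.tau_lt_s_lastRound j).le
  rw [p.tau_eq hj] at h2
  have hε := p.ε_pos
  have h3 : 32 / p.ε ^ 2 * (p.logTerm + 2 * Real.log j) * (p.ε * Y) ^ 2
      ≤ p.s (p.lastRound j) * (p.ε * Y) ^ 2 := by gcongr
  have h4 : 32 / p.ε ^ 2 * (p.logTerm + 2 * Real.log j) * (p.ε * Y) ^ 2
      = 32 * (p.logTerm + 2 * Real.log j) * Y ^ 2 := by field_simp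
  have h5 := p.four_le_logTerm
  have h6 : 0 ≤ Real.log j := Real.log_natCast_nonneg j
  have h7 : 0 ≤ 64 * Y ^ 2 - 1 := by nlinarith
  have h8 : (64 * Y ^ 2 - 1) * 4 ≤ (64 * Y ^ 2 - 1) * (p.logTerm + 2 * Real.log j) := by
    gcongr
    linarith
  nlinarith

lemma Params.exp_overestimate_init_le (p : Params) {y : ℝ} (hy : 3 / 8 * p.ε ≤ y) :
    Real.exp (-2 * p.s 1 * y ^ 2) ≤ p.δ / (p.C * p.k) := by
  rw [← p.exp_neg_logTerm, Real.exp_le_exp]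
  have h1 := p.le_s le_rfl
  have h2 := p.base_mul_sq
  have h3 := p.four_le_logTerm
  have hε := p.ε_pos
  have h4 : (3 / 8 * p.ε) ^ 2 ≤ y ^ 2 := by gcongr
  have h5 : p.base * 2 ^ 1 * (3 / 8 * p.ε) ^ 2 ≤ p.s 1 * y ^ 2 := by
    have := p.one_le_base'
    gcongr
  nlinarith

/-! ### The potential of a state -/

variable {n : ℕ}

/-- The potential of a state, relative to the critical level `h`. -/
noncomputable def potential (p : Params) (tie : Finset (Fin n) → Fin n) (h : ℝ) (st : State n) :
    ℝ :=
  ∑ a ∈ st.A, armPotential ((st.est a - h) / p.ε)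
    + counterWeight ((st.est (tie st.argmin) - h) / p.ε) * (2 / st.j)

lemma potential_nonneg (p : Params) (tie : Finset (Fin n) → Fin n) (h : ℝ) (st : State n) :
    0 ≤ potential p tie h st := by
  have := counterWeight_pos ((st.est (tie st.argmin) - h) / p.ε)
  exact add_nonneg (Finset.sum_nonneg fun a _ => armPotential_nonneg _) (by positivity)

lemma measurable_armPotential : Measurable armPotential := by
  unfold armPotential
  fun_prop

lemma measurable_counterWeight : Measurable counterWeight := by
  unfold counterWeight
  fun_prop

lemma measurable_potential (p : Params) (tie : Finset (Fin n) → Fin n) (h : ℝ) :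
    Measurable fun st : State n => potential p tie h st := by
  have hev : ∀ a, Measurable fun q : (Fin n → ℝ) × Unit => (q.1 a - h) / p.ε := fun a => by
    have : Measurable fun q : (Fin n → ℝ) × Unit => q.1 a :=
      (measurable_pi_apply a).comp measurable_fst
    exact (this.sub_const h).div_const p.ε
  have h1 : Measurable fun q : State n × Unit => potential p tie h q.1 := by
    refine measurable_of_state_prod fun A j => ?_
    have hsum : Measurable fun q : (Fin n → ℝ) × Unit =>
        ∑ a ∈ A, armPotential ((q.1 a - h) / p.ε) :=
      Finset.measurable_sum _ fun a _ => measurable_armPotential.comp (hev a)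
    have htop : Measurable fun q : (Fin n → ℝ) × Unit =>
        counterWeight ((q.1 (tie (⟨A, q.1, j⟩ : State n).argmin) - h) / p.ε) :=
      measurable_of_top tie A j (f := fun q a => counterWeight ((q.1 a - h) / p.ε)) fun a =>
        measurable_counterWeight.comp (hev a)
    exact hsum.add (htop.mul_const (2 / (j : ℝ)))
  have h2 : Measurable fun st : State n => (st, ()) := measurable_prodMk_right
  have h3 : Measurable fun st : State n => potential p tie h (st, ()).1 := h1.comp h2
  exact h3

lemma le_threshold (p : Params) (tie : Finset (Fin n) → Fin n) (st : State n) (u : ℝ) :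
    st.est (tie st.argmin) + p.ε / 4 ≤ threshold p tie st u ∧
      threshold p tie st u ≤ st.est (tie st.argmin) + p.ε / 2 := by
  have := p.ε_pos
  unfold threshold
  split_ifs <;> constructor <;> linarith

section Step

variable {p : Params} {tie : Finset (Fin n) → Fin n} {h : ℝ} {st : State n} {a : Fin n}
  {l : List (Fin n)} {x : ℕ → ℝ} {u : ℝ}

lemma Params.Accepts.le_avg_lastRound {θ : ℝ} {j : ℕ} (hacc : p.Accepts θ j x) :
    θ ≤ p.avg x (p.lastRound j) :=
  hacc _ (Finset.mem_Icc.mpr ⟨p.one_le_lastRound j, le_rfl⟩)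

/-- The new minimum lies between the old one and the new estimate, which are at least ε/4 apart. By
`four_mul_counterWeight_le`, half of the logistic drop pays for the new counter term, whose factor
2/j is now 2; the other half and the whole old counter term are gained. -/
lemma potential_step_of_accepts (htie : ∀ S : Finset (Fin n), S.Nonempty → tie S ∈ S)
    (hst : st.Ready p (a :: l)) (hl : (a :: l).Nodup)
    (hacc : p.Accepts (threshold p tie st u) st.j x) :
    potential p tie h (stepState p tie a st x u) ≤ potential p tie h st
      - (armPotential ((st.est (tie st.argmin) - h) / p.ε)
          - armPotential ((p.avg x (p.lastRound st.j) - h) / p.ε)) / 2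
      - counterWeight ((st.est (tie st.argmin) - h) / p.ε) * (2 / st.j) := by
  have hε := p.ε_pos
  obtain ⟨htop, hmin⟩ := hst.top_mem htie
  have ha : a ∉ st.A := hst.notMem a (by simp)
  have ha' : a ∉ st.A.erase (tie st.argmin) := fun h' => ha (Finset.mem_of_mem_erase h')
  have hstep : stepState p tie a st x u =
      { A := insert a (st.A.erase (tie st.argmin)),
        est := Function.update st.est a (p.avg x (p.lastRound st.j)), j := 1 } := if_pos hacc
  have hready := hst.step hl htie x u
  obtain ⟨htop', hmin'⟩ := hready.top_mem htie
  set st' := stepState p tie a st x u with hst'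
  set e := p.avg x (p.lastRound st.j) with he
  have hA : st'.A = insert a (st.A.erase (tie st.argmin)) := by rw [hstep]
  have hesta : st'.est a = e := by rw [hstep]; simp
  have hestb : ∀ b ∈ st.A, st'.est b = st.est b := by
    intro b hb
    rw [hstep]
    exact Function.update_of_ne (ne_of_mem_of_not_mem hb ha) _ _
  have hj : st'.j = 1 := by rw [hstep]
  have hθ := hacc.le_avg_lastRound
  have hθ' := (le_threshold p tie st u).1
  have h1 : st'.est (tie st'.argmin) ≤ e := by
    rw [← hesta]
    exact hmin' a (by rw [hA]; simp)
  have h2 : st.est (tie st.argmin) ≤ st'.est (tie st'.argmin) := by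
    rw [hA] at htop'
    rcases Finset.mem_insert.mp htop' with h' | h'
    · rw [h', hesta]
      linarith
    · have hb := Finset.mem_of_mem_erase h'
      rw [hestb _ hb]
      exact hmin _ hb
  have hsum : ∑ b ∈ st'.A, armPotential ((st'.est b - h) / p.ε) =
      armPotential ((e - h) / p.ε) + (∑ b ∈ st.A, armPotential ((st.est b - h) / p.ε)
        - armPotential ((st.est (tie st.argmin) - h) / p.ε)) := by
    rw [hA, Finset.sum_insert ha', hesta, ← Finset.sum_erase_eq_sub htop]
    congr 1
    refine Finset.sum_congr rfl fun b hb => ?_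
    rw [hestb b (Finset.mem_of_mem_erase hb)]
  have hkey : 4 * counterWeight ((st'.est (tie st'.argmin) - h) / p.ε) ≤
      armPotential ((st.est (tie st.argmin) - h) / p.ε) - armPotential ((e - h) / p.ε) := by
    refine four_mul_counterWeight_le ?_ (by gcongr) (by gcongr)
    rw [← sub_nonneg]
    have : (e - h) / p.ε - ((st.est (tie st.argmin) - h) / p.ε + 1 / 4)
        = (e - (st.est (tie st.argmin) + p.ε / 4)) / p.ε := by field_simp; ring
    rw [this]
    exact _root_.div_nonneg (by linarith) hε.le
  unfold potential
  rw [hsum, hj]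
  push_cast
  linarith

/-- A rejection changes only the counter, and 2/(j+1) ≤ 2/j - 1/j². An acceptance removes the old
term 2/j altogether. -/
lemma potential_step_le (htie : ∀ S : Finset (Fin n), S.Nonempty → tie S ∈ S)
    (hst : st.Ready p (a :: l)) (hl : (a :: l).Nodup) :
    potential p tie h (stepState p tie a st x u) ≤ potential p tie h st
      - counterWeight ((st.est (tie st.argmin) - h) / p.ε) * (1 / (st.j : ℝ) ^ 2) := by
  have hw := counterWeight_pos ((st.est (tie st.argmin) - h) / p.ε)
  have hj : (1 : ℝ) ≤ st.j := by exact_mod_cast hst.one_le_j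
  by_cases hacc : p.Accepts (threshold p tie st u) st.j x
  · refine (potential_step_of_accepts htie hst hl hacc).trans ?_
    have h1 : 1 / (st.j : ℝ) ^ 2 ≤ 2 / st.j := by
      rw [div_le_div_iff₀ (by positivity) (by positivity)]
      nlinarith
    have h2 : armPotential ((p.avg x (p.lastRound st.j) - h) / p.ε)
        ≤ armPotential ((st.est (tie st.argmin) - h) / p.ε) := by
      refine armPotential_antitone ?_
      have := hacc.le_avg_lastRound
      have := (le_threshold p tie st u).1
      have := p.ε_pos
      gcongr
      linarith
    have h3 := mul_le_mul_of_nonneg_left h1 hw.le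
    linarith
  · have hstep : stepState p tie a st x u = { A := st.A, est := st.est, j := st.j + 1 } :=
      if_neg hacc
    have harg : (stepState p tie a st x u).argmin = st.argmin := by
      rw [hstep]; rfl
    unfold potential
    rw [harg, hstep]
    have h1 : (2 : ℝ) / (st.j + 1 : ℕ) ≤ 2 / st.j - 1 / (st.j : ℝ) ^ 2 := by
      have : (2 : ℝ) / st.j - 1 / (st.j : ℝ) ^ 2 = (2 * st.j - 1) / (st.j : ℝ) ^ 2 := by
        field_simp
      rw [this, div_le_div_iff₀ (by positivity) (by positivity)]
      push_cast
      nlinarith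
    have h3 := mul_le_mul_of_nonneg_left h1 hw.le
    linarith

end Step

/-! ### The expected number of overestimated arms -/

/-- The acceptance of an arm of small mean with an estimate above the critical level. -/
def IsOverestimated (m : Fin n → ℝ) (h : ℝ) (p : Params) (tie : Finset (Fin n) → Fin n) (a : Fin n)
    (st : State n) (x : ℕ → ℝ) (u : ℝ) : Prop :=
  m a + 3 / 8 * p.ε < h ∧ p.Accepts (threshold p tie st u) st.j x ∧
    h ≤ p.avg x (p.lastRound st.j)

open Classical in
/-- The number of the overestimated arms. -/
noncomputable def overCost (m : Fin n → ℝ) (h : ℝ) (p : Params) (tie : Finset (Fin n) → Fin n)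
    (a : Fin n) (st : State n) (x : ℕ → ℝ) (u : ℝ) : ℝ≥0∞ :=
  if IsOverestimated m h p tie a st x u then 1 else 0

lemma measurable_overCost (m : Fin n → ℝ) (h : ℝ) (p : Params) (tie : Finset (Fin n) → Fin n)
    (a : Fin n) :
    Measurable fun q : State n × ((ℕ → ℝ) × ℝ) => overCost m h p tie a q.1 q.2.1 q.2.2 := by
  classical
  refine measurable_of_state_prod fun A j => ?_
  have h1 : MeasurableSet {q : (Fin n → ℝ) × ((ℕ → ℝ) × ℝ) | h ≤ p.avg q.2.1 (p.lastRound j)} :=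
    measurableSet_le measurable_const ((measurable_avg p _).comp measurable_snd.fst)
  exact Measurable.ite (MeasurableSet.inter (MeasurableSet.const _) (MeasurableSet.inter
    ((measurable_threshold_fixed p tie A j) (measurableSet_accepts p j)) h1))
    measurable_const measurable_const

variable {Ω : Type u} [MeasurableSpace Ω]

namespace IsModel

variable {ν : Fin n → Measure ℝ} {P : Measure Ω} {X : Fin n → ℕ → Ω → ℝ} {U : ℕ → Ω → ℝ}

/-- Measured in units of δ/(Ck), the probability of an overestimate is at most the expected decrease
of the potential. The counter term pays when the smallest estimate is not far below the mean of the
arriving arm; otherwise that arm is likely to be accepted, and its logistic term pays. -/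
lemma lintegral_overCost_step_le (H : IsModel ν P X U) (p : Params)
    {tie : Finset (Fin n) → Fin n} (htie : ∀ S : Finset (Fin n), S.Nonempty → tie S ∈ S)
    (h : ℝ) (a : Fin n) (l : List (Fin n)) (hl : (a :: l).Nodup) (st : State n) (m : ℕ)
    (hst : st.Ready p (a :: l)) :
    ∫⁻ ω, (overCost (fun i => ∫ x, x ∂(ν i)) h p tie a st (fun r => X a r ω) (U m ω)
        + ENNReal.ofReal (p.δ / (p.C * p.k) *
          potential p tie h (stepState p tie a st (fun r => X a r ω) (U m ω)))) ∂P
      ≤ ENNReal.ofReal (p.δ / (p.C * p.k) * potential p tie h st) := by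
  classical
  have := H.prob
  have hε := p.ε_pos
  have hD : 0 < p.δ / (p.C * p.k) := p.exp_neg_logTerm ▸ Real.exp_pos _
  have hj : (1 : ℝ) ≤ st.j := by exact_mod_cast hst.one_le_j
  set D := p.δ / (p.C * p.k) with hDdef
  set v := st.est (tie st.argmin) with hv
  set w := counterWeight ((v - h) / p.ε) with hw
  have hwpos : 0 < w := counterWeight_pos _
  set Φ := potential p tie h st with hΦ
  have hstep : ∀ ω, potential p tie h (stepState p tie a st (fun r => X a r ω) (U m ω))
      ≤ Φ - w * (1 / (st.j : ℝ) ^ 2) := fun ω => potential_step_le htie hst hl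
  by_cases hm : (∫ x, x ∂(ν a)) + 3 / 8 * p.ε < h
  swap
  · calc _ ≤ ∫⁻ _, ENNReal.ofReal (D * Φ) ∂P := by
          refine lintegral_mono fun ω => ?_
          have h0 : overCost (fun i => ∫ x, x ∂(ν i)) h p tie a st (fun r => X a r ω) (U m ω) = 0 :=
            if_neg fun h' => hm h'.1
          simp only [h0, zero_add]
          refine ENNReal.ofReal_le_ofReal ?_
          gcongr
          have := hstep ω
          have : 0 < w * (1 / (st.j : ℝ) ^ 2) := by positivity
          linarith
      _ = _ := by simp
  set q := (h - ∫ x, x ∂(ν a)) / p.ε with hq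
  have hqm : p.ε * q = h - ∫ x, x ∂(ν a) := by rw [hq]; field_simp
  have hq38 : 3 / 8 < q := by rw [hq, lt_div_iff₀ hε]; linarith
  set z := (v - h) / p.ε with hz
  have hzv : p.ε * z = v - h := by rw [hz]; field_simp
  -- An overestimated arm is recorded above both h and the threshold, which is at least v + ε/4;
  -- these lie q and q + z + 1/4 above its mean, in units of ε.
  set Y := max q (q + z + 1 / 4) with hY
  have hY38 : 3 / 8 ≤ Y := hq38.le.trans (le_max_left _ _)
  have hfail : ∫⁻ ω, overCost (fun i => ∫ x, x ∂(ν i)) h p tie a st (fun r => X a r ω) (U m ω) ∂P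
      ≤ ENNReal.ofReal (D * (1 / (st.j : ℝ) ^ 2) * Real.exp (-80 * Y)) := by
    set G := {ω | (∫ x, x ∂(ν a)) + p.ε * Y ≤ p.avg (fun r => X a r ω) (p.lastRound st.j)} with hG
    have hGm : MeasurableSet G :=
      measurableSet_le measurable_const ((measurable_avg p _).comp (H.measurable_row a))
    calc _ ≤ ∫⁻ ω, G.indicator (fun _ => 1) ω ∂P := by
          refine lintegral_mono fun ω => ?_
          simp only [overCost]
          split_ifs with h'
          · obtain ⟨-, h2, h3⟩ := h'
            have h4 := h2.le_avg_lastRound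
            have h5 := (le_threshold p tie st (U m ω)).1
            have hω : ω ∈ G := by
              rw [hG, Set.mem_ofPred_eq, hY, mul_max_of_nonneg _ _ hε.le, ← le_sub_iff_add_le',
                max_le_iff]
              constructor
              · linarith
              · have : p.ε * (q + z + 1 / 4) = p.ε * q + p.ε * z + p.ε / 4 := by ring
                linarith
            simp [hω]
          · exact zero_le
      _ = P G := by simp [lintegral_indicator hGm]
      _ ≤ _ := H.measure_avg_ge_le p a (p.one_le_lastRound _) (by positivity)
      _ ≤ _ := ENNReal.ofReal_le_ofReal (p.exp_overestimate_le hst.one_le_j hY38)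
  have hcost : Measurable fun ω =>
      overCost (fun i => ∫ x, x ∂(ν i)) h p tie a st (fun r => X a r ω) (U m ω) :=
    (measurable_overCost _ h p tie a).comp
      (measurable_const.prodMk ((H.measurable_row a).prodMk (H.measurable_U m)))
  rw [lintegral_add_left hcost]
  -- Equivalently, the smallest estimate is at least the mean of the arm minus ε.
  by_cases hcase : -z - 1 ≤ q
  · have h1 : Real.exp (-80 * Y) ≤ w := by
      refine exp_le_counterWeight hY38 (abs_le.mpr ⟨?_, ?_⟩)
      · linarith [le_max_left q (q + z + 1 / 4)]
      · linarith [le_max_right q (q + z + 1 / 4)]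
    calc _ ≤ ENNReal.ofReal (D * (1 / (st.j : ℝ) ^ 2) * w) +
          ∫⁻ _, ENNReal.ofReal (D * (Φ - w * (1 / (st.j : ℝ) ^ 2))) ∂P := by
          refine add_le_add (hfail.trans (ENNReal.ofReal_le_ofReal (by gcongr))) ?_
          refine lintegral_mono fun ω => ENNReal.ofReal_le_ofReal ?_
          exact mul_le_mul_of_nonneg_left (hstep ω) hD.le
      _ = _ := by
          have h2 : 0 ≤ Φ - w * (1 / (st.j : ℝ) ^ 2) := by
            obtain ⟨ω⟩ := nonempty_of_isProbabilityMeasure P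
            exact (potential_nonneg _ _ _ _).trans (hstep ω)
          rw [lintegral_const, measure_univ, mul_one, ← ENNReal.ofReal_add (by positivity)
            (by positivity)]
          congr 1
          ring
  · have hz1 : z ≤ -q - 1 := by linarith
    have h1 : Real.exp (-80 * Y) ≤ Real.exp (-q) :=
      Real.exp_le_exp.mpr (by linarith [le_max_left q (q + z + 1 / 4)])
    have hacc : ∀ ω ∈ noUnder ν X p a,
        potential p tie h (stepState p tie a st (fun r => X a r ω) (U m ω))
          ≤ Φ - 2 * Real.exp (-q) := by
      intro ω hω
      have h2 : v + p.ε / 2 ≤ (∫ x, x ∂(ν a)) - p.ε / 8 := by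
        have := mul_le_mul_of_nonneg_left hz1 hε.le
        have h' : p.ε * (-q - 1) = - (p.ε * q) - p.ε := by ring
        linarith
      have h3 : p.Accepts (threshold p tie st (U m ω)) st.j (fun r => X a r ω) := by
        intro r hr
        exact ((le_threshold p tie st (U m ω)).2.trans h2).trans (hω r (Finset.mem_Icc.mp hr).1)
      refine (potential_step_of_accepts htie hst hl h3).trans ?_
      have h4 : -q - 1 / 8 ≤ (p.avg (fun r => X a r ω) (p.lastRound st.j) - h) / p.ε := by
        rw [le_div_iff₀ hε]
        have := hω _ (p.one_le_lastRound st.j)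
        have h' : (-q - 1 / 8) * p.ε = -(p.ε * q) - p.ε / 8 := by ring
        linarith
      have h5 := four_mul_exp_neg_le (by linarith) hz1 h4
      have h6 : 0 < w * (2 / (st.j : ℝ)) := by positivity
      linarith
    -- `ENNReal.ofReal` truncates at 0, so the lowered value must be nonnegative; it dominates an
    -- actual potential on a nonempty event.
    have hΦ2 : 0 ≤ Φ - 2 * Real.exp (-q) := by
      have hne : (noUnder ν X p a).Nonempty := by
        rw [Set.nonempty_iff_ne_empty]
        intro h0
        have := H.half_le_measure_noUnder p a
        rw [h0] at this
        norm_num at this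
      obtain ⟨ω, hω⟩ := hne
      exact (potential_nonneg _ _ _ _).trans (hacc ω hω)
    have hΦ0 : 0 ≤ Φ := potential_nonneg _ _ _ _
    have hdrop : ∫⁻ ω, ENNReal.ofReal (D *
        potential p tie h (stepState p tie a st (fun r => X a r ω) (U m ω))) ∂P
        ≤ ENNReal.ofReal (D * Φ - D * (2 * Real.exp (-q)) * (1 / 2)) := by
      refine lintegral_le_of_drop (H.measurableSet_noUnder p a) (by positivity) (by gcongr; linarith)
        (by norm_num) (by norm_num) (H.half_le_measure_noUnder p a) ?_ ?_
      · intro ω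
        refine ENNReal.ofReal_le_ofReal ?_
        gcongr
        have := hstep ω
        have : 0 < w * (1 / (st.j : ℝ) ^ 2) := by positivity
        linarith
      · intro ω hω
        refine ENNReal.ofReal_le_ofReal ?_
        rw [← mul_sub]
        exact mul_le_mul_of_nonneg_left (hacc ω hω) hD.le
    have hj2 : 1 / (st.j : ℝ) ^ 2 ≤ 1 := by
      rw [div_le_one (by positivity)]
      nlinarith
    calc _ ≤ ENNReal.ofReal (D * Real.exp (-q)) +
          ENNReal.ofReal (D * Φ - D * (2 * Real.exp (-q)) * (1 / 2)) := by
          refine add_le_add (hfail.trans (ENNReal.ofReal_le_ofReal ?_)) hdrop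
          calc D * (1 / (st.j : ℝ) ^ 2) * Real.exp (-80 * Y) ≤ D * 1 * Real.exp (-q) := by gcongr
            _ = _ := by ring
      _ = _ := by
          have h7 : 0 ≤ D * (Φ - 2 * Real.exp (-q)) := by positivity
          have h8 : 0 < D * Real.exp (-q) := by positivity
          rw [← ENNReal.ofReal_add h8.le (by nlinarith)]
          congr 1
          ring

end IsModel

end StreamingBandit

namespace StreamingBandit

open Params
open scoped ENNReal

variable {n : ℕ}

/-! ### The state after the first arms -/

lemma initState_eq (p : Params) (X : Fin n → ℕ → ℝ) (l : List (Fin n)) (hl : l.Nodup)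
    (st : State n) :
    initState p X l st = { A := st.A ∪ l.toFinset,
                           est := fun a => if a ∈ l then p.avg (X a) 1 else st.est a,
                           j := st.j } := by
  induction l generalizing st with
  | nil => simp [initState]
  | cons a l ih =>
    rw [initState, ih (List.nodup_cons.mp hl).2]
    congr 1
    · ext b
      simp only [Finset.mem_union, Finset.mem_insert, List.mem_toFinset, List.mem_cons]
      tauto
    · funext b
      by_cases hb : b ∈ l
      · simp [hb]
      · by_cases hab : b = a
        · subst hab
          simp [hb]
        · simp [hb, hab]

/-- The first `k` arms. -/
def firstArms (p : Params) (n : ℕ) : Finset (Fin n) := ((List.finRange n).take p.k).toFinset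

lemma nodup_take (p : Params) (n : ℕ) : ((List.finRange n).take p.k).Nodup :=
  (List.nodup_finRange n).sublist (List.take_sublist _ _)

lemma nodup_drop (p : Params) (n : ℕ) : ((List.finRange n).drop p.k).Nodup :=
  (List.nodup_finRange n).sublist (List.drop_sublist _ _)

lemma card_firstArms (p : Params) (hkn : p.k ≤ n) : (firstArms p n).card = p.k := by
  rw [firstArms, List.toFinset_card_of_nodup (nodup_take p n)]
  simpa using hkn

lemma notMem_firstArms (p : Params) {a : Fin n} (ha : a ∈ (List.finRange n).drop p.k) :
    a ∉ firstArms p n := by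
  intro h
  have := (List.nodup_finRange n)
  rw [← List.take_append_drop p.k (List.finRange n)] at this
  exact List.disjoint_of_nodup_append this (List.mem_toFinset.mp h) ha

lemma mem_firstArms_or (p : Params) (a : Fin n) :
    a ∈ firstArms p n ∨ a ∈ (List.finRange n).drop p.k := by
  have := List.mem_finRange a
  rw [← List.take_append_drop p.k (List.finRange n), List.mem_append] at this
  simpa [firstArms] using this

lemma startState_eq (p : Params) (X : Fin n → ℕ → ℝ) :
    startState p n X = { A := firstArms p n,
                         est := fun a => if a ∈ firstArms p n then p.avg (X a) 1 else 0,
                         j := 1 } := by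
  rw [startState, initState_eq p X _ (nodup_take p n)]
  simp [firstArms]

lemma startState_ready (p : Params) (hkn : p.k ≤ n) (X : Fin n → ℕ → ℝ) :
    (startState p n X).Ready p ((List.finRange n).drop p.k) := by
  rw [startState_eq]
  exact ⟨card_firstArms p hkn, le_rfl, fun a ha => notMem_firstArms p ha⟩

/-! ### Correctness of an execution without estimation errors -/

section Deterministic

variable {m : Fin n → ℝ} {κ : ℝ} {p : Params} {tie : Finset (Fin n) → Fin n} {T : Finset (Fin n)}

/-- The invariant of an execution without estimation errors, when the arms in `l` are still to come;
`T` is a set of `k` arms with means at least `κ`. -/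
structure Invariant (m : Fin n → ℝ) (κ : ℝ) (p : Params) (T : Finset (Fin n)) (l : List (Fin n))
    (st : State n) : Prop where
  ready : st.Ready p l
  sound : ∀ a ∈ st.A, κ - p.ε ≤ m a ∨ st.est a < κ - 5 / 8 * p.ε
  complete : (∀ a ∈ st.A, κ - 5 / 8 * p.ε ≤ st.est a) ∨
    ∀ i ∈ T, i ∉ l → i ∈ st.A ∧ κ - 5 / 8 * p.ε ≤ st.est i

/-- If the minimum is below the critical level κ - 5ε/8, the threshold is below κ - ε/8: an arriving
arm of T passes every round, and the evicted arm is not a stored arm of T with a good estimate. If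
the minimum is at least the level, it remains so, since estimates are only replaced by larger ones.
Soundness of a new arm is `hover`, because κ - ε = (κ - 5ε/8) - 3ε/8. -/
lemma Invariant.step (htie : ∀ S : Finset (Fin n), S.Nonempty → tie S ∈ S)
    (hT : ∀ i ∈ T, κ ≤ m i) {a : Fin n} {l : List (Fin n)} (hl : (a :: l).Nodup) {st : State n}
    {x : ℕ → ℝ} {u : ℝ} (hinv : Invariant m κ p T (a :: l) st)
    (hover : ¬ IsOverestimated m (κ - 5 / 8 * p.ε) p tie a st x u)
    (hunder : a ∈ T → ∀ r, 1 ≤ r → m a - p.ε / 8 ≤ p.avg x r) :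
    Invariant m κ p T l (stepState p tie a st x u) := by
  have hready := hinv.ready.step hl htie x u
  obtain ⟨htop, hmin⟩ := hinv.ready.top_mem htie
  have ha : a ∉ st.A := hinv.ready.notMem a (by simp)
  have hε := p.ε_pos
  obtain ⟨hθ1, hθ2⟩ := le_threshold p tie st u
  by_cases hacc : p.Accepts (threshold p tie st u) st.j x
  · have hstep : stepState p tie a st x u =
        { A := insert a (st.A.erase (tie st.argmin)),
          est := Function.update st.est a (p.avg x (p.lastRound st.j)), j := 1 } := if_pos hacc
    have he := hacc.le_avg_lastRound
    have hestb : ∀ b ∈ st.A, Function.update st.est a (p.avg x (p.lastRound st.j)) b = st.est b :=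
      fun b hb => Function.update_of_ne (ne_of_mem_of_not_mem hb ha) _ _
    rw [hstep] at hready ⊢
    refine ⟨hready, ?_, ?_⟩
    · intro b hb
      rcases Finset.mem_insert.mp hb with rfl | hb'
      · simp only [Function.update_self]
        by_contra hcon
        push Not at hcon
        exact hover ⟨by linarith [hcon.1], hacc, hcon.2⟩
      · have hb'' := Finset.mem_of_mem_erase hb'
        simp only [hestb b hb'']
        exact hinv.sound b hb''
    · by_cases hv : κ - 5 / 8 * p.ε ≤ st.est (tie st.argmin)
      · left
        intro b hb
        rcases Finset.mem_insert.mp hb with rfl | hb'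
        · simp only [Function.update_self]
          linarith
        · have hb'' := Finset.mem_of_mem_erase hb'
          simp only [hestb b hb'']
          exact hv.trans (hmin b hb'')
      · right
        intro i hi hil
        by_cases hia : i = a
        · subst hia
          refine ⟨Finset.mem_insert_self _ _, ?_⟩
          simp only [Function.update_self]
          linarith [hunder hi _ (p.one_le_lastRound st.j), hT i hi]
        · rcases hinv.complete with h | h
          · exact absurd (h _ htop) hv
          · obtain ⟨h1, h2⟩ := h i hi (by simp [hia, hil])
            refine ⟨Finset.mem_insert_of_mem (Finset.mem_erase.mpr ⟨?_, h1⟩), ?_⟩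
            · rintro rfl
              exact hv h2
            · simp only [hestb i h1]
              exact h2
  · have hstep : stepState p tie a st x u = { A := st.A, est := st.est, j := st.j + 1 } :=
      if_neg hacc
    rw [hstep] at hready ⊢
    refine ⟨hready, hinv.sound, ?_⟩
    by_cases hv : κ - 5 / 8 * p.ε ≤ st.est (tie st.argmin)
    · exact Or.inl fun b hb => hv.trans (hmin b hb)
    · right
      intro i hi hil
      rcases hinv.complete with h | h
      · exact absurd (h _ htop) hv
      · by_cases hia : i = a
        · subst hia
          refine absurd (fun r hr => ?_) hacc
          have := hunder hi r (Finset.mem_Icc.mp hr).1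
          have := hT i hi
          linarith
        · exact h i hi (by simp [hia, hil])

/-- The cost counts overestimated arms, each with value 1, so a total below 1 excludes all of them.
-/
lemma Invariant.run (htie : ∀ S : Finset (Fin n), S.Nonempty → tie S ∈ S)
    (hT : ∀ i ∈ T, κ ≤ m i) {X : Fin n → ℕ → ℝ} {U : ℕ → ℝ}
    (hunder : ∀ i ∈ T, ∀ r, 1 ≤ r → m i - p.ε / 8 ≤ p.avg (X i) r)
    {l : List (Fin n)} (hl : l.Nodup) {st : State n} {c : ℕ} (hinv : Invariant m κ p T l st)
    (hcost : runCost p tie (overCost m (κ - 5 / 8 * p.ε) p tie) X U l st c < 1) :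
    Invariant m κ p T [] (runState p tie X U l st c) := by
  induction l generalizing st c with
  | nil => exact hinv
  | cons a l ih =>
    rw [runCost] at hcost
    refine ih (List.nodup_cons.mp hl).2 (hinv.step htie hT hl ?_ (hunder a))
      (lt_of_le_of_lt le_add_self hcost)
    intro hover
    have h1 : overCost m (κ - 5 / 8 * p.ε) p tie a st (X a) (U c) = 1 := if_pos hover
    rw [h1] at hcost
    exact absurd hcost (not_lt.mpr le_self_add)

/-- When every arm of T is stored, equal cardinality forces `st.A = T`. So each alternative of
`complete` puts all estimates above the critical level. -/
lemma Invariant.final (hTk : T.card = p.k) {st : State n} (hinv : Invariant m κ p T [] st) :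
    st.A.card = p.k ∧ ∀ a ∈ st.A, κ - p.ε ≤ m a := by
  refine ⟨hinv.ready.card, fun a ha => (hinv.sound a ha).resolve_right (not_lt.mpr ?_)⟩
  rcases hinv.complete with h | h
  · exact h a ha
  · have hsub : T ⊆ st.A := fun i hi => (h i hi (by simp)).1
    have hTA : T = st.A := Finset.eq_of_subset_of_card_le hsub (by rw [hTk, hinv.ready.card])
    exact (h a (hTA ▸ ha) (by simp)).2

lemma startState_invariant (hkn : p.k ≤ n) (hT : ∀ i ∈ T, κ ≤ m i) {X : Fin n → ℕ → ℝ}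
    (hunder : ∀ i ∈ T, ∀ r, 1 ≤ r → m i - p.ε / 8 ≤ p.avg (X i) r)
    (hinit : ∀ a ∈ firstArms p n, κ - p.ε ≤ m a ∨ p.avg (X a) 1 < κ - 5 / 8 * p.ε) :
    Invariant m κ p T ((List.finRange n).drop p.k) (startState p n X) := by
  have hready := startState_ready p hkn X
  rw [startState_eq] at hready ⊢
  refine ⟨hready, fun a ha => ?_, Or.inr fun i hi hil => ?_⟩
  · simpa [show a ∈ firstArms p n from ha] using hinit a ha
  · have hi' := (mem_firstArms_or p i).resolve_right hil
    refine ⟨hi', ?_⟩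
    simp only [hi', if_true]
    linarith [hunder i hi 1 le_rfl, hT i hi, p.ε_pos]

end Deterministic

/-! ### The largest means -/

/-- Taking the last k positions of the sorted order gives exactly k arms even when means coincide.
-/
lemma exists_top_set (f : Fin n → ℝ) (k : ℕ) (hk : 1 ≤ k) (hkn : k ≤ n) :
    ∃ T : Finset (Fin n), T.card = k ∧ ∀ i ∈ T, kthLargest f k hk hkn ≤ f i := by
  refine ⟨(Finset.Ici (⟨n - k, by omega⟩ : Fin n)).map (Tuple.sort f).toEmbedding, ?_, ?_⟩
  · rw [Finset.card_map, Fin.card_Ici]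
    simp only
    omega
  · intro i hi
    obtain ⟨r, hr, rfl⟩ := Finset.mem_map.mp hi
    exact Tuple.monotone_sort f (Finset.mem_Ici.mp hr)

/-! ### The main estimates -/

variable {Ω : Type u} [MeasurableSpace Ω]

namespace IsModel

variable {ν : Fin n → Measure ℝ} {P : Measure Ω} {X : Fin n → ℕ → Ω → ℝ} {U : ℕ → Ω → ℝ}

/-- The rewards of the first `k` arms. -/
def firstData (p : Params) (n : ℕ) : Set ((Fin n × ℕ) ⊕ ℕ) :=
  {s | ∃ a ∈ firstArms p n, ∃ r, s = Sum.inl (a, r)}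

omit [MeasurableSpace Ω] in
lemma measurable_startState (X : Fin n → ℕ → Ω → ℝ) (U : ℕ → Ω → ℝ) (p : Params) :
    Measurable[sigma X U (firstData p n)] fun ω => startState p n (fun i r => X i r ω) := by
  simp only [startState_eq]
  refine @measurable_state_mk n Ω (sigma X U (firstData p n)) (fun _ => firstArms p n)
    (fun ω a => if a ∈ firstArms p n then p.avg (fun r => X a r ω) 1 else 0) (fun _ => 1)
    measurable_const ?_ measurable_const
  refine @measurable_pi_lambda _ _ _ (sigma X U (firstData p n)) _ _ fun a => ?_
  by_cases ha : a ∈ firstArms p n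
  · simp only [ha, if_true]
    exact (measurable_avg p 1).comp (measurable_path fun r => ⟨a, ha, r, rfl⟩)
  · simp only [ha, if_false]
    exact measurable_const

lemma lintegral_runCost_startState_le (H : IsModel ν P X U) (p : Params) (hkn : p.k ≤ n)
    {tie : Finset (Fin n) → Fin n}
    (htie : ∀ S : Finset (Fin n), S.Nonempty → tie S ∈ S)
    {cost : Fin n → State n → (ℕ → ℝ) → ℝ → ℝ≥0∞}
    (hcost : ∀ i, Measurable fun q : State n × ((ℕ → ℝ) × ℝ) => cost i q.1 q.2.1 q.2.2)
    {Φ : State n → ℝ≥0∞} (hΦ : Measurable Φ) (B : ℝ≥0∞)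
    (hstep : ∀ (a : Fin n) (l : List (Fin n)) (st : State n) (m : ℕ), (a :: l).Nodup →
      st.Ready p (a :: l) → ∫⁻ ω, (cost a st (fun r => X a r ω) (U m ω)
        + Φ (stepState p tie a st (fun r => X a r ω) (U m ω))) ∂P ≤ Φ st + B) :
    (Measurable fun ω => runCost p tie cost (fun i r => X i r ω) (fun r => U r ω)
      ((List.finRange n).drop p.k) (startState p n fun i r => X i r ω) 0) ∧
    ∫⁻ ω, runCost p tie cost (fun i r => X i r ω) (fun r => U r ω)
      ((List.finRange n).drop p.k) (startState p n fun i r => X i r ω) 0 ∂P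
      ≤ ∫⁻ ω, Φ (startState p n fun i r => X i r ω) ∂P + n * B := by
  have h := H.lintegral_runCost_le p htie hcost hΦ B hstep _ (nodup_drop p n)
    (fun ω => startState p n fun i r => X i r ω) 0 (firstData p n)
    (measurable_startState X U p) (fun ω => startState_ready p hkn _)
    (by
      rintro a ha r ⟨b, hb, r', h⟩
      simp only [Sum.inl.injEq, Prod.mk.injEq] at h
      exact notMem_firstArms p ha (h.1 ▸ hb))
    (by
      rintro r - ⟨b, hb, r', h⟩
      simp at h)
  refine ⟨h.1, h.2.trans ?_⟩
  gcongr
  simp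

/-- In units of `base`: 4n for the first rounds, 8 ≤ 8n for the initial credit, and 44n for the
steps. -/
theorem lintegral_numPulls_le (H : IsModel ν P X U) (p : Params) (hkn : p.k ≤ n)
    {tie : Finset (Fin n) → Fin n} (htie : ∀ S : Finset (Fin n), S.Nonempty → tie S ∈ S) :
    ∫⁻ ω, ((topKAlgorithm p n tie).numPulls (fun i m => X i m ω) (fun m => U m ω) : ℝ≥0∞) ∂P
      ≤ ENNReal.ofReal (56 * n * p.base) := by
  have := H.prob
  have hb := p.one_le_base'
  have hn : (1 : ℝ) ≤ n := by exact_mod_cast p.one_le_k.trans hkn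
  have hmeas : Measurable fun st : State n => ENNReal.ofReal (credit p st.j) :=
    ENNReal.measurable_ofReal.comp
      ((measurable_of_countable (credit p)).comp measurable_tuple.snd.snd)
  obtain ⟨-, h⟩ := H.lintegral_runCost_startState_le p hkn htie (measurable_pullCost p tie) hmeas
    (ENNReal.ofReal (44 * p.base))
    (fun a l st m _ hst => H.lintegral_pullCost_step_le p tie a l st m hst)
  calc _ ≤ ∫⁻ ω, (((n * p.s 1 : ℕ) : ℝ≥0∞) + runCost p tie (pullCost p tie) (fun i r => X i r ω)
        (fun r => U r ω) ((List.finRange n).drop p.k) (startState p n fun i r => X i r ω) 0) ∂P :=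
        lintegral_mono fun ω => (exec_topKAlgorithm p n tie _ _).2.2
    _ ≤ ((n * p.s 1 : ℕ) : ℝ≥0∞) + (ENNReal.ofReal (8 * p.base)
        + n * ENNReal.ofReal (44 * p.base)) := by
        rw [lintegral_add_left measurable_const, lintegral_const, measure_univ, mul_one]
        refine add_le_add le_rfl (h.trans (add_le_add (le_of_eq ?_) le_rfl))
        simp [startState_eq, credit]
    _ ≤ _ := by
        rw [← ENNReal.ofReal_natCast, ← ENNReal.ofReal_natCast n,
          ← ENNReal.ofReal_mul (by positivity), ← ENNReal.ofReal_add (by positivity)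
          (by positivity), ← ENNReal.ofReal_add (by positivity) (by positivity)]
        refine ENNReal.ofReal_le_ofReal ?_
        have h1 := p.s_le le_rfl
        push_cast
        nlinarith

lemma potential_startState_le (p : Params) (hkn : p.k ≤ n) (tie : Finset (Fin n) → Fin n) (h : ℝ)
    (x : Fin n → ℕ → ℝ) : potential p tie h (startState p n x) ≤ 38 * p.k := by
  have hk := p.one_le_natCast_k
  have hready := startState_ready p hkn x
  have h1 : ∑ a ∈ (startState p n x).A, armPotential (((startState p n x).est a - h) / p.ε)
      ≤ p.k * 36 := by
    rw [← hready.card, ← nsmul_eq_mul]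
    exact Finset.sum_le_card_nsmul _ _ _ fun a _ => armPotential_le _
  have h2 := counterWeight_le_one
    (((startState p n x).est (tie (startState p n x).argmin) - h) / p.ε)
  have h3 : (startState p n x).j = 1 := by rw [startState_eq]
  unfold potential
  rw [h3]
  push_cast
  linarith

/-- With D = δ/(Ck), underestimates in T cost 2kD, overestimates among the first arms kD, and later
overestimates 38kD by Markov's inequality; together 41δ/C ≤ δ. Covering the space by the success
event and these three avoids measurability of the former. -/
theorem one_sub_le_measure_isEpsTopK (H : IsModel ν P X U) (p : Params) (hkn : p.k ≤ n)
    {tie : Finset (Fin n) → Fin n} (htie : ∀ S : Finset (Fin n), S.Nonempty → tie S ∈ S) :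
    ENNReal.ofReal (1 - p.δ) ≤ P {ω | IsEpsTopK (fun i => ∫ x, x ∂(ν i)) p.k p.one_le_k hkn p.ε
      ((topKAlgorithm p n tie).output (fun i m => X i m ω) (fun m => U m ω))} := by
  have := H.prob
  have hk := p.one_le_natCast_k
  have hε := p.ε_pos
  set m : Fin n → ℝ := fun i => ∫ x, x ∂(ν i) with hm
  set κ := kthLargest m p.k p.one_le_k hkn with hκ
  set D := p.δ / (p.C * p.k) with hD
  have hD0 : 0 < D := by
    rw [hD, ← p.exp_neg_logTerm]
    exact Real.exp_pos _
  obtain ⟨T, hTk, hT⟩ := exists_top_set m p.k p.one_le_k hkn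
  set cost : Ω → ℝ≥0∞ := fun ω => runCost p tie (overCost m (κ - 5 / 8 * p.ε) p tie)
    (fun i r => X i r ω) (fun r => U r ω) ((List.finRange n).drop p.k)
    (startState p n fun i r => X i r ω) 0 with hcost
  set G := {ω | IsEpsTopK m p.k p.one_le_k hkn p.ε
    ((topKAlgorithm p n tie).output (fun i m => X i m ω) (fun m => U m ω))} with hG
  set E₁ : Set Ω := ⋃ i ∈ T, (noUnder ν X p i)ᶜ with hE₁
  set E₂ : Set Ω := ⋃ a ∈ firstArms p n,
    {ω | m a < κ - p.ε ∧ κ - 5 / 8 * p.ε ≤ p.avg (fun r => X a r ω) 1} with hE₂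
  set E₃ : Set Ω := {ω | 1 ≤ cost ω} with hE₃
  have hcover : Set.univ ⊆ G ∪ (E₁ ∪ (E₂ ∪ E₃)) := by
    intro ω _
    by_contra hω
    simp only [Set.mem_union, not_or] at hω
    obtain ⟨hωG, h1, h2, h3⟩ := hω
    have hunder : ∀ i ∈ T, ∀ r, 1 ≤ r → m i - p.ε / 8 ≤ p.avg (fun s => X i s ω) r := by
      intro i hi
      by_contra hcon
      exact h1 (Set.mem_biUnion hi hcon)
    have hinit : ∀ a ∈ firstArms p n,
        κ - p.ε ≤ m a ∨ p.avg (fun r => X a r ω) 1 < κ - 5 / 8 * p.ε := by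
      intro a ha
      by_contra hcon
      push Not at hcon
      exact h2 (Set.mem_biUnion ha hcon)
    have hfin := ((startState_invariant hkn hT hunder hinit).run htie hT hunder (nodup_drop p n)
      (not_le.mp h3)).final hTk
    refine hωG ?_
    rw [hG, Set.mem_ofPred_eq, (exec_topKAlgorithm p n tie _ _).1]
    exact hfin
  have hP1 : P E₁ ≤ ENNReal.ofReal (p.k * (2 * D)) := by
    calc P E₁ ≤ ∑ i ∈ T, P (noUnder ν X p i)ᶜ := measure_biUnion_finset_le _ _
      _ ≤ ∑ _ ∈ T, ENNReal.ofReal (2 * D) :=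
        Finset.sum_le_sum fun i _ => H.measure_noUnder_compl_le p i
      _ = _ := by
        rw [Finset.sum_const, hTk, nsmul_eq_mul, ENNReal.ofReal_mul (Nat.cast_nonneg p.k),
          ENNReal.ofReal_natCast]
  have hP2 : P E₂ ≤ ENNReal.ofReal (p.k * D) := by
    calc P E₂ ≤ ∑ a ∈ firstArms p n,
          P {ω | m a < κ - p.ε ∧ κ - 5 / 8 * p.ε ≤ p.avg (fun r => X a r ω) 1} :=
          measure_biUnion_finset_le _ _
      _ ≤ ∑ _ ∈ firstArms p n, ENNReal.ofReal D := by
          refine Finset.sum_le_sum fun a _ => ?_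
          by_cases ha : m a < κ - p.ε
          · refine le_trans (measure_mono (t := {ω | m a + (κ - 5 / 8 * p.ε - m a)
                ≤ p.avg (fun r => X a r ω) 1}) ?_)
              ((H.measure_avg_ge_le p a le_rfl (by linarith)).trans
                (ENNReal.ofReal_le_ofReal (p.exp_overestimate_init_le (by linarith))))
            rintro ω ⟨-, h⟩
            rw [Set.mem_ofPred_eq]
            linarith
          · simp [ha]
      _ = _ := by
          rw [Finset.sum_const, card_firstArms p hkn, nsmul_eq_mul,
            ENNReal.ofReal_mul (by positivity), ENNReal.ofReal_natCast]
  have hP3 : P E₃ ≤ ENNReal.ofReal (D * (38 * p.k)) := by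
    obtain ⟨h1, h2⟩ := H.lintegral_runCost_startState_le p hkn htie
      (measurable_overCost m (κ - 5 / 8 * p.ε) p tie)
      (Φ := fun st => ENNReal.ofReal (D * potential p tie (κ - 5 / 8 * p.ε) st))
      (((measurable_potential p tie _).const_mul D).ennreal_ofReal) 0
      (fun a l st c hl hst => by
        rw [add_zero]
        exact H.lintegral_overCost_step_le p htie _ a l hl st c hst)
    calc P E₃ ≤ ∫⁻ ω, cost ω ∂P := by
          simpa using mul_meas_ge_le_lintegral (μ := P) h1 1
      _ ≤ _ := h2
      _ ≤ ∫⁻ _, ENNReal.ofReal (D * (38 * p.k)) ∂P := by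
          rw [mul_zero, add_zero]
          refine lintegral_mono fun ω => ENNReal.ofReal_le_ofReal ?_
          exact mul_le_mul_of_nonneg_left (potential_startState_le p hkn tie _ _) hD0.le
      _ = _ := by simp
  have hsum : P (E₁ ∪ (E₂ ∪ E₃)) ≤ ENNReal.ofReal p.δ := by
    calc _ ≤ P E₁ + (P E₂ + P E₃) :=
          (measure_union_le _ _).trans (add_le_add le_rfl (measure_union_le _ _))
      _ ≤ ENNReal.ofReal (p.k * (2 * D)) + (ENNReal.ofReal (p.k * D)
          + ENNReal.ofReal (D * (38 * p.k))) := by gcongr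
      _ ≤ _ := by
          rw [← ENNReal.ofReal_add (by positivity) (by positivity),
            ← ENNReal.ofReal_add (by positivity) (by positivity)]
          refine ENNReal.ofReal_le_ofReal ?_
          have h1 : p.k * D = p.δ / p.C := by
            rw [hD]
            field_simp
          have h2 : p.δ / p.C ≤ p.δ / 100 :=
            div_le_div_of_nonneg_left p.δ_pos.le (by norm_num) p.hundred_le_C
          have := p.δ_pos
          nlinarith
  have h1 : (1 : ℝ≥0∞) ≤ P G + ENNReal.ofReal p.δ := by
    calc (1 : ℝ≥0∞) = P Set.univ := measure_univ.symm
      _ ≤ P G + P (E₁ ∪ (E₂ ∪ E₃)) := (measure_mono hcover).trans (measure_union_le _ _)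
      _ ≤ _ := by gcongr
  rw [ENNReal.ofReal_sub _ p.δ_pos.le, ENNReal.ofReal_one]
  exact tsub_le_iff_right.mpr h1

end IsModel

end StreamingBandit

/-! ### Conclusion and choice of the constant -/

theorem theorem2 (C : ℝ) (hC : 100 ≤ C) :
    ∃ K : ℝ, 0 < K ∧
      ∀ (n k : ℕ) (hk : 1 ≤ k) (hkn : k ≤ n) (ε δ : ℝ) (hε : 0 < ε) (hε1 : ε < 1)
        (hδ : 0 < δ) (hδ1 : δ < 1)
        -- any rule for breaking ties between arms of equal estimated mean
        (tie : Finset (Fin n) → Fin n) (_htie : ∀ S : Finset (Fin n), S.Nonempty → tie S ∈ S),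
        let alg := topKAlgorithm ⟨k, ε, δ, C, hk, hε, hε1, hδ, hδ1, hC⟩ n tie
        -- a single pass and a single-arm memory, in every execution
        (∀ (X : Fin n → ℕ → ℝ) (U : ℕ → ℝ), SinglePassWithMemory 1 (alg.trace X U)) ∧
        -- reward distributions `ν i` on `[0, 1]`, independent rewards and uniform seeds of the coins
        ∀ (ν : Fin n → Measure ℝ) (_hν : ∀ i, IsProbabilityMeasure (ν i))
          (_hν01 : ∀ i, ∀ᵐ x ∂(ν i), x ∈ Set.Icc (0 : ℝ) 1)
          (Ω : Type*) (_ : MeasurableSpace Ω) (P : Measure Ω) (_hP : IsProbabilityMeasure P)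
          (X : Fin n → ℕ → Ω → ℝ) (U : ℕ → Ω → ℝ)
          (_hX : ∀ i m, Measurable (X i m)) (_hU : ∀ m, Measurable (U m))
          (_hXlaw : ∀ i m, P.map (X i m) = ν i)
          (_hUlaw : ∀ m, P.map (U m) = volume.restrict (Set.Icc (0 : ℝ) 1))
          (_hindep : iIndepFun
            (Sum.elim (fun q : Fin n × ℕ => X q.1 q.2) U : (Fin n × ℕ) ⊕ ℕ → Ω → ℝ) P),
          -- correctness
          ENNReal.ofReal (1 - δ) ≤
            P {ω | IsEpsTopK (fun i => ∫ x, x ∂(ν i)) k hk hkn ε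
              (alg.output (fun i m => X i m ω) (fun m => U m ω))} ∧
          -- expected number of pulls
          ∫⁻ ω, (alg.numPulls (fun i m => X i m ω) (fun m => U m ω) : ENNReal) ∂P ≤
            ENNReal.ofReal (K * (n / ε ^ 2) * (1 + Real.log (k / δ))) ∧
          (2 * δ ≤ k →
            ∫⁻ ω, (alg.numPulls (fun i m => X i m ω) (fun m => U m ω) : ENNReal) ∂P ≤
              ENNReal.ofReal (K * (n / ε ^ 2) * Real.log (k / δ))) := by
  have hlogC : 0 ≤ Real.log C := Real.log_nonneg (by linarith)
  -- Here 896 = 56 · 16. The factor 2 is for the second bound: k/δ ≥ 2 gives log(k/δ) ≥ 1/2, hence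
  -- log C ≤ 2 log C · log(k/δ).
  refine ⟨896 * (1 + 2 * Real.log C), by positivity, ?_⟩
  intro n k hk hkn ε δ hε hε1 hδ hδ1 tie htie
  set p : Params := ⟨k, ε, δ, C, hk, hε, hε1, hδ, hδ1, hC⟩ with hp
  refine ⟨fun X U => singlePassWithMemory_one_of_pairwise (exec_topKAlgorithm p n tie X U).2.1, ?_⟩
  intro ν _ hν01 Ω _ P hP X U hX hU hXlaw hUlaw hindep
  have H : IsModel ν P X U := ⟨hP, hν01, hX, hU, hXlaw, hUlaw, hindep⟩
  have hk' : (1 : ℝ) ≤ k := by exact_mod_cast hk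
  have hkδ : 1 ≤ k / δ := by rw [le_div_iff₀ hδ]; linarith
  have hlog : 0 ≤ Real.log (k / δ) := Real.log_nonneg hkδ
  have hL : p.logTerm = Real.log C + Real.log (k / δ) := by
    rw [Params.logTerm, ← Real.log_mul (by positivity) (by positivity)]
    congr 1
    rw [hp]
    ring
  have hpulls := H.lintegral_numPulls_le p hkn htie
  have hbase : 56 * n * p.base = 896 * (n / ε ^ 2) * (Real.log C + Real.log (k / δ)) := by
    rw [← hL, Params.base]
    change 56 * n * (16 / ε ^ 2 * p.logTerm) = _
    ring
  rw [hbase] at hpulls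
  have hfac : 0 ≤ 896 * (n / ε ^ 2) := by positivity
  refine ⟨H.one_sub_le_measure_isEpsTopK p hkn htie, hpulls.trans ?_, fun h2 => hpulls.trans ?_⟩
  · refine ENNReal.ofReal_le_ofReal ?_
    have : Real.log C + Real.log (k / δ) ≤ (1 + 2 * Real.log C) * (1 + Real.log (k / δ)) := by
      nlinarith [mul_nonneg hlogC hlog]
    calc _ ≤ 896 * (n / ε ^ 2) * ((1 + 2 * Real.log C) * (1 + Real.log (k / δ))) := by gcongr
      _ = _ := by ring
  · refine ENNReal.ofReal_le_ofReal ?_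
    have h3 : 1 / 2 ≤ Real.log (k / δ) := by
      have h4 : Real.log 2 ≤ Real.log (k / δ) :=
        Real.log_le_log (by norm_num) (by rw [le_div_iff₀ hδ]; exact h2)
      linarith [Real.log_two_gt_d9]
    have : Real.log C + Real.log (k / δ) ≤ (1 + 2 * Real.log C) * Real.log (k / δ) := by
      nlinarith
    calc _ ≤ 896 * (n / ε ^ 2) * ((1 + 2 * Real.log C) * Real.log (k / δ)) := by gcongr
      _ = _ := by ring
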